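/- **Setting.** Fix integers $d,T$. Let $\mathbf L$ be the space of real block lower triangular $dT\times dT$ matrices with $d\times d$ blocks, $\mathbf O\subset\mathbf L$ the group of block diagonal matrices with orthogonal $d\times d$ diagonal blocks, $A_{t,t}$ the $t$-th diagonal block of $A$, and $\|\cdot\|_{\rm F}$ the Frobenius norm. Let $G=(G_1,\dots,G_T)$ consist of independent standard Gaussian vectors of $\mathbb R^d$, with filtration $\mathcal G_t=\sigma(G_s:s\le t)$. For $L,M\in\mathbf L$ let $d_{\rm ABW}(L,M)$ be the adapted $2$-Wasserstein distance between the processes $LG$ and $MG$, both with the filtration $(\mathcal G_t)$, i.e. $d_{\rm ABW}^2(L,M)=\inf_\pi\mathbb E_\pi|LG-MG'|^2$ over all bicausal couplings $\pi$ of two copies $G,G'$ of the filtered Gaussian basis. The same symbol denotes the quotient distance on $\mathbf L/_{\mathbf O}$, whose elements are the classes $[L]=\{LO:O\in\mathbf O\}$. A geodesic between $[L]$ and $[M]$ is a curve $\gamma:[0,1]\to\mathbf L/_{\mathbf O}$ with $\gamma(0)=[L]$, $\gamma(1)=[M]$ and $d_{\rm ABW}(\gamma(u),\gamma(v))=|u-v|\,d_{\rm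 ABW}([L],[M])$ for all $u,v\in[0,1]$. Let $$\mathbf O^*(L,M)=\operatorname*{arg\,min}_{O\in\mathbf O}\|L-MO\|_{\rm F},\qquad \mathcal V(L)=\{V\in\mathbf L:(V^\top L)_{t,t}\text{ is symmetric for all }t\},$$ and call $L\in\mathbf L$ regular if $(L^\top L)_{t,t}$ is positive definite for all $t$. The angle $\angle(\gamma,\eta)\in[0,\pi]$ of two geodesics $\gamma,\eta$ of nonzero speed that start at $[L]$ is given by $$\cos\angle(\gamma,\eta)=\lim_{u\downarrow0}\frac{d_{\rm ABW}^2([L],\gamma(u))+d_{\rm ABW}^2([L],\eta(u))-d_{\rm ABW}^2(\gamma(u),\eta(u))}{2\,d_{\rm ABW}([L],\gamma(u))\,d_{\rm ABW}([L],\eta(u))}.$$ The space of directions at $[L]$ is the completion with respect to $\angle$ of the set of these geodesics, those with angle $0$ being identified. The tangent cone $\mathbf T([L])$ is the Euclidean cone over the space of directions, with metric $d_{\mathbf T([L])}^2((\xi,r),(\zeta,s))=r^2+s^2-2rs\cos\angle(\xi,\zeta)$, all points of radius $0$ being identified with the tip. The initial velocity of a geodesic $\gamma$ between $[L]$ and $[M]$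 is the point of $\mathbf T([L])$ with the direction of $\gamma$ and radius $d_{\rm ABW}([L],[M])$ (the tip if $[L]=[M]$). If there is exactly one geodesic between $[L]$ and $[M]$, one says that $\log_{[L]}([M])$ exists, and it is the initial velocity of this geodesic. **Theorem.** Let $L\in\mathbf L$ be regular. There is a bijective isometry $$\iota_L:(\mathbf T([L]),d_{\mathbf T([L])})\to(\mathcal V(L),\|\cdot\|_{\rm F})$$ which, for every $V\in\mathcal V(L)$ for which $u\mapsto[L+uV]$, $u\in[0,1]$, is a geodesic between $[L]$ and $[L+V]$, sends the initial velocity of this geodesic to $V$, and such that for every $M\in\mathbf L$ the following holds. 1. There is a unique geodesic between $[L]$ and $[M]$ if and only if ${\rm rk}((M^\top M)_{t,t})={\rm rk}((M^\top L)_{t,t})$ for all $t=1,\dots,T$. 2. In that case $\mathbf O^*(L,M)$ is nonempty and, for every $P\in\mathbf O^*(L,M)$, one has $MP-L\in\mathcal V(L)$, $\log_{[L]}([M])$ exists, $$\log_{[L]}([M])=\iota_L^{-1}(MP-L),$$ and the unique geodesic between $[L]$ and $[M]$ is $u\mapsto[L+u(MP-L)]$, $u\in[0,1]$. -/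

import Mathlib

open MeasureTheory ProbabilityTheory Filter Topology
open scoped Matrix unitInterval

noncomputable section

namespace AdaptedBW

/-! ### Adapted Wasserstein distance, through bicausal couplings -/

section AdaptedWasserstein

variable {T : ℕ} {Ω Ω' : Type*} [mΩ : MeasurableSpace Ω] [mΩ' : MeasurableSpace Ω']
  [StandardBorelSpace Ω] [StandardBorelSpace Ω']

/-- `π` is a bicausal coupling of the filtered probability spaces `(Ω, P, ℱ)` and `(Ω', Q, 𝒢)`:
its marginals are `P` and `Q`, and, for every time `t`, under `π` the final σ-algebra of the first
space is independent of `𝒢 t` given `ℱ t`, and the final σ-algebra of the second space is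
independent of `ℱ t` given `𝒢 t`. (At the final time both conditions hold automatically.) -/
structure IsBicausalCoupling (ℱ : Filtration (Fin T) mΩ) (P : Measure Ω)
    (𝒢 : Filtration (Fin T) mΩ') (Q : Measure Ω') (π : Measure (Ω × Ω')) [IsFiniteMeasure π] :
    Prop where
  fst : π.map Prod.fst = P
  snd : π.map Prod.snd = Q
  causal : ∀ t : Fin T,
    CondIndep ((ℱ t).comap Prod.fst) ((⨆ s, ℱ s).comap Prod.fst) ((𝒢 t).comap Prod.snd)
      ((MeasurableSpace.comap_mono (ℱ.le t)).trans measurable_fst.comap_le) π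
  anticausal : ∀ t : Fin T,
    CondIndep ((𝒢 t).comap Prod.snd) ((⨆ s, 𝒢 s).comap Prod.snd) ((ℱ t).comap Prod.fst)
      ((MeasurableSpace.comap_mono (𝒢.le t)).trans measurable_snd.comap_le) π

/-- The adapted `2`-Wasserstein distance between square integrable adapted processes `X` on
`(Ω, P, ℱ)` and `Y` on `(Ω', Q, 𝒢)`; a process is read as a random vector, whose coordinates
are indexed by `K` (space and time). -/
def adaptedWasserstein {K : Type*} [Fintype K]
    (ℱ : Filtration (Fin T) mΩ) (P : Measure Ω) (X : Ω → K → ℝ)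
    (𝒢 : Filtration (Fin T) mΩ') (Q : Measure Ω') (Y : Ω' → K → ℝ) : ℝ :=
  Real.sqrt (sInf {c : ℝ | ∃ π : ProbabilityMeasure (Ω × Ω'),
    IsBicausalCoupling ℱ P 𝒢 Q (π : Measure (Ω × Ω')) ∧
    c = ∫ z, ∑ k, (X z.1 k - Y z.2 k) ^ 2 ∂(π : Measure (Ω × Ω'))})

end AdaptedWasserstein

/-! ### The Gaussian basis and block lower triangular matrices

Matrices of size `dT × dT` are indexed by `Fin d × Fin T`: the pair `(i, t)` is the `i`-th
coordinate at time `t`. With this convention `Matrix.blockDiag A t` is the block `A_{t,t}` and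
`Matrix.blockDiagonal Q` is the block diagonal matrix with diagonal blocks `Q t`. -/

/-- The space that carries the Gaussian vectors: `ω (·, t)` is the value of `G_t`. -/
abbrev Path (T d : ℕ) : Type := Fin d × Fin T → ℝ

/-- The law under which the coordinates `G_1, …, G_T` are independent `d`-dimensional standard
Gaussian vectors. -/
def gaussianLaw (T d : ℕ) : Measure (Path T d) :=
  Measure.pi fun _ => gaussianReal 0 1

/-- The filtration `𝒢_t = σ(G_s : s ≤ t)`. -/
def gaussianFiltration (T d : ℕ) :
    Filtration (Fin T) (MeasurableSpace.pi : MeasurableSpace (Path T d)) where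
  seq t := ⨆ k : {k : Fin d × Fin T // k.2 ≤ t},
    MeasurableSpace.comap (fun ω : Path T d => ω k.1) inferInstance
  mono' := fun _ _ hst => iSup_le fun k =>
    le_iSup_of_le (f := fun k : {k : Fin d × Fin T // k.2 ≤ _} =>
      MeasurableSpace.comap (fun ω : Path T d => ω k.1) inferInstance) ⟨k.1, k.2.trans hst⟩ le_rfl
  le' := fun _ => iSup_le fun k => (measurable_pi_apply k.1).comap_le

/-- The space `𝐋` of block lower triangular matrices. -/
def BlockLower (T d : ℕ) : Submodule ℝ (Matrix (Fin d × Fin T) (Fin d × Fin T) ℝ) where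
  carrier := {L | ∀ a b, a.2 < b.2 → L a b = 0}
  add_mem' := fun hA hB a b h => by simp [hA a b h, hB a b h]
  zero_mem' := fun _ _ _ => rfl
  smul_mem' := fun c A hA a b h => by simp [hA a b h]

/-- The group `𝐎`: a family `(O_t)` of orthogonal `d × d` matrices, which stands for the block
diagonal matrix `diag(O_1, …, O_T)`, see `OGroup.toMatrix`. -/
abbrev OGroup (T d : ℕ) : Type := Fin T → Matrix.orthogonalGroup (Fin d) ℝ

/-- The block diagonal matrix of a family of orthogonal matrices. -/
def OGroup.toMatrix {T d : ℕ} (O : OGroup T d) : Matrix (Fin d × Fin T) (Fin d × Fin T) ℝ :=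
  Matrix.blockDiagonal fun t => (O t : Matrix (Fin d) (Fin d) ℝ)

variable {T d : ℕ}

/-- An element of `𝐋` as a matrix. -/
abbrev mat (L : BlockLower T d) : Matrix (Fin d × Fin T) (Fin d × Fin T) ℝ := L.1

/-- The block `(Aᵀ B)_{t,t}`. -/
def gramBlock (A B : BlockLower T d) (t : Fin T) : Matrix (Fin d) (Fin d) ℝ :=
  ((mat A)ᵀ * mat B).blockDiag t

/-- The product `M O`, for `M ∈ 𝐋` and `O ∈ 𝐎`, as an element of `𝐋`. -/
def mulO (M : BlockLower T d) (O : OGroup T d) : BlockLower T d :=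
  ⟨mat M * O.toMatrix, fun a b h => by
    rw [Matrix.mul_apply]
    refine Finset.sum_eq_zero fun c _ => ?_
    by_cases hc : c.2 = b.2
    · have h0 : mat M a c = 0 := M.2 a c (hc ▸ h)
      exact mul_eq_zero_of_left h0 _
    · simp [OGroup.toMatrix, Matrix.blockDiagonal_apply, hc]⟩

/-- The Frobenius norm. -/
def frobNorm {m n : Type*} [Fintype m] [Fintype n] (A : Matrix m n ℝ) : ℝ :=
  Real.sqrt (∑ i, ∑ j, A i j ^ 2)

/-- `d_ABW(L, M)`: the adapted Wasserstein distance between the processes `L G` and `M G`, both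
with the filtration generated by `G`. -/
def dABW (L M : BlockLower T d) : ℝ :=
  adaptedWasserstein
    (gaussianFiltration T d) (gaussianLaw T d) (fun ω => mat L *ᵥ ω)
    (gaussianFiltration T d) (gaussianLaw T d) (fun ω => mat M *ᵥ ω)

theorem OGroup.toMatrix_one : (1 : OGroup T d).toMatrix = 1 :=
  Matrix.blockDiagonal_one

theorem OGroup.toMatrix_mul (O O' : OGroup T d) :
    (O * O').toMatrix = O.toMatrix * O'.toMatrix :=
  Matrix.blockDiagonal_mul _ _

theorem mulO_one (L : BlockLower T d) : mulO L 1 = L :=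
  Subtype.ext (by change mat L * _ = mat L; rw [OGroup.toMatrix_one, mul_one])

theorem mulO_mulO (L : BlockLower T d) (O O' : OGroup T d) :
    mulO (mulO L O) O' = mulO L (O * O') :=
  Subtype.ext (by
    change mat L * O.toMatrix * O'.toMatrix = mat L * (O * O').toMatrix
    rw [OGroup.toMatrix_mul, Matrix.mul_assoc])

/-- The equivalence relation `L ∼ M` iff `L = M O` for some `O ∈ 𝐎`. -/
def orbitSetoid (T d : ℕ) : Setoid (BlockLower T d) where
  r L M := ∃ O : OGroup T d, L = mulO M O
  iseqv :=
    { refl := fun L => ⟨1, (mulO_one L).symm⟩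
      symm := fun {L M} ⟨O, h⟩ => ⟨O⁻¹, by rw [h, mulO_mulO, mul_inv_cancel, mulO_one]⟩
      trans := fun {L M N} ⟨O, h⟩ ⟨O', h'⟩ => ⟨O' * O, by rw [h, h', mulO_mulO]⟩ }

/-- The adapted Bures-Wasserstein space `𝐋 / 𝐎`. -/
def ABWSpace (T d : ℕ) : Type := Quotient (orbitSetoid T d)

/-- The class `[L]`. -/
def cls (L : BlockLower T d) : ABWSpace T d := Quotient.mk (orbitSetoid T d) L

/-- The quotient distance on `𝐋 / 𝐎`. -/
def distABW (x y : ABWSpace T d) : ℝ :=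
  sInf {c : ℝ | ∃ L M : BlockLower T d, cls L = x ∧ cls M = y ∧ c = dABW L M}

/-- `L ∈ 𝐋^reg`: all the diagonal blocks `(Lᵀ L)_{t,t}` are positive definite. -/
def IsRegularBW (L : BlockLower T d) : Prop :=
  ∀ t, (gramBlock L L t).PosDef

/-- `𝐎*(L, M)`: the minimizers of `O ↦ ‖L - M O‖_F` over `𝐎`. -/
def optO (L M : BlockLower T d) : Set (OGroup T d) :=
  {P | ∀ O : OGroup T d, frobNorm (mat (L - mulO M P)) ≤ frobNorm (mat (L - mulO M O))}

/-- `𝒱(L)`: the `V ∈ 𝐋` for which all the diagonal blocks `(Vᵀ L)_{t,t}` are symmetric. -/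
def tangentSpace (L : BlockLower T d) : Set (BlockLower T d) :=
  {V | ∀ t, (gramBlock V L t).IsSymm}

/-! ### Geodesics, angles, tangent cone and logarithm, for a set `X` with a distance `δ` -/

section Alexandrov

variable {X : Type*} (δ : X → X → ℝ)

/-- `γ` is a constant speed geodesic, parametrized by `[0, 1]`, from `x` to `y`. -/
def IsGeodesic (x y : X) (γ : I → X) : Prop :=
  γ 0 = x ∧ γ 1 = y ∧ ∀ u v : I, δ (γ u) (γ v) = |(u : ℝ) - v| * δ x y

/-- The constant speed geodesics that start at `p` and have nonzero speed. -/
structure NonconstGeodesic (p : X) where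
  toFun : I → X
  isGeodesic : IsGeodesic δ p (toFun 1) toFun
  speed_pos : 0 < δ p (toFun 1)

/-- The cosine of the comparison angle at `p` of the points `x` and `y`. -/
def comparisonCos (p x y : X) : ℝ :=
  (δ p x ^ 2 + δ p y ^ 2 - δ x y ^ 2) / (2 * δ p x * δ p y)

variable {δ}

/-- The angle at `p` between two geodesics, the limit of the comparison angles of
`γ u` and `η u` as `u ↓ 0`. -/
def angle {p : X} (γ η : NonconstGeodesic δ p) : ℝ :=
  Real.arccos (limUnder (𝓝[>] (0 : I)) fun u => comparisonCos δ p (γ.toFun u) (η.toFun u))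

variable (δ)

/-- Cauchy sequences of geodesics with respect to the angle. -/
def CauchyGeodesics (p : X) : Type _ :=
  {s : ℕ → NonconstGeodesic δ p // ∀ ε > 0, ∃ N, ∀ m ≥ N, ∀ n ≥ N, angle (s m) (s n) < ε}

/-- The space of directions at `p`: the completion, with respect to the angle, of the nonconstant
geodesics that start at `p`, geodesics with angle `0` being identified. Its points are the Cauchy
sequences, up to sequences whose angle tends to `0`. -/
def Directions (p : X) : Type _ :=
  Quot fun s s' : CauchyGeodesics δ p =>
    Tendsto (fun n => angle (s.1 n) (s'.1 n)) atTop (𝓝 0)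

variable {δ}

/-- The angle between two directions, the continuous extension of the angle of geodesics. -/
def Directions.angle {p : X} (ξ ζ : Directions δ p) : ℝ :=
  limUnder atTop fun n => AdaptedBW.angle (ξ.out.1 n) (ζ.out.1 n)

variable (δ)

/-- The tangent cone at `p`: the cone `Directions × [0, ∞)` with all the points of radius `0`
identified with the tip. (The tip is there even if there is no direction at all.) -/
inductive TangentCone (p : X) : Type _
  | tip : TangentCone p
  | ray (ξ : Directions δ p) (r : ℝ) (hr : 0 < r) : TangentCone p

variable {δ}

/-- The cone metric `r² + s² - 2 r s cos ∠`, under the square root. -/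
def TangentCone.dist {p : X} : TangentCone δ p → TangentCone δ p → ℝ
  | tip, tip => 0
  | tip, ray _ s _ => s
  | ray _ r _, tip => r
  | ray ξ r _, ray ζ s _ => Real.sqrt (r ^ 2 + s ^ 2 - 2 * r * s * Real.cos (ξ.angle ζ))

theorem angle_self {p : X} (γ : NonconstGeodesic δ p) : angle γ γ = 0 := by
  have hbot : (𝓝[>] (0 : I)).NeBot := nhdsGT_neBot_of_exists_gt ⟨1, zero_lt_one⟩
  have h : Tendsto (fun u => comparisonCos δ p (γ.toFun u) (γ.toFun u)) (𝓝[>] (0 : I)) (𝓝 1) := by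
    refine tendsto_const_nhds.congr' ?_
    filter_upwards [self_mem_nhdsWithin] with u hu
    obtain ⟨h0, -, hd⟩ := γ.isGeodesic
    have hu' : (0 : ℝ) < u := hu
    have h1 : δ (γ.toFun u) (γ.toFun u) = 0 := by simp [hd u u]
    have h2 : 0 < δ p (γ.toFun u) := by
      have := hd 0 u
      rw [h0] at this
      rw [this]
      have h3 : |((0 : I) : ℝ) - u| = u := by simp [abs_of_pos hu']
      rw [h3]
      exact mul_pos hu' γ.speed_pos
    rw [comparisonCos, h1]
    field_simp
    norm_num
  rw [angle, h.limUnder_eq, Real.arccos_one]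

/-- The direction of a geodesic of nonzero speed. -/
def NonconstGeodesic.direction {p : X} (γ : NonconstGeodesic δ p) : Directions δ p :=
  Quot.mk _ ⟨fun _ => γ, fun _ hε => ⟨0, fun _ _ _ _ => (angle_self γ).trans_lt hε⟩⟩

open Classical in
/-- The initial velocity, in the tangent cone at `p`, of a constant speed geodesic `γ` from `p`
to `q`: the direction of `γ` with radius `δ p q`, and the tip if `γ` has speed zero. -/
def velocity {p q : X} (γ : I → X) (hγ : IsGeodesic δ p q γ) : TangentCone δ p :=
  if h : 0 < δ p q then
    .ray (NonconstGeodesic.direction ⟨γ, hγ.2.1.symm ▸ hγ, hγ.2.1.symm ▸ h⟩) (δ p q) h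
  else .tip

/-- `log_p q` exists and is `v`: there is exactly one constant speed geodesic from `p` to `q`, and
its initial velocity is `v`. -/
def HasLog (p q : X) (v : TangentCone δ p) : Prop :=
  ∃ (γ : I → X) (hγ : IsGeodesic δ p q γ), (∀ η, IsGeodesic δ p q η → η = γ) ∧ v = velocity γ hγ

end Alexandrov

/-- The curve `u ↦ [L + u V]` in `𝐋 / 𝐎`. -/
def displacement (L V : BlockLower T d) : I → ABWSpace T d := fun u => cls (L + (u : ℝ) • V)

/-- The properties of the isometry `ι_L` between the tangent cone at `[L]` and `(𝒱(L), ‖·‖_F)`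
that fixes the representative `L`: it is an isometric bijection, and, for `V ∈ 𝒱(L)` for which
`u ↦ [L + u V]` is a constant speed geodesic, it sends the initial velocity of this
geodesic to `V`. There is at most one such map for regular `L`. -/
structure IsTangentIsometry (L : BlockLower T d)
    (ι : TangentCone distABW (cls L) ≃ tangentSpace L) : Prop where
  isometry : ∀ x y, frobNorm (mat ((ι x : BlockLower T d) - (ι y : BlockLower T d))) = x.dist y
  velocity : ∀ (V : tangentSpace L)
    (h : IsGeodesic distABW (cls L) (cls (L + V.1)) (displacement L V.1)),
    ι (velocity (displacement L V.1) h) = V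

end AdaptedBW

end

open AdaptedBW

/-! The proof identifies the quotient with an orbit space of a Euclidean space and then does
first-order geometry there. For a bicausal coupling let C be the matrix of mixed moments E[G_a
G'_b]. An increment of one basis is independent of the earlier past of the other, so C is block
diagonal; nonnegativity of E(x·G - y·G')² makes its blocks contractions. The cost ‖L‖² + ‖M‖² - 2
tr(C MᵀL) thus sees only the blocks (MᵀL)_{t,t}, and the trace of such a block against a contraction
is maximal at an orthogonal polar factor. The coupling G' = OG attains the bound, so the distance is
min ‖L - MO‖ over O (`dABW_eq_norm`, `distABW_cls`): right multiplication by the block diagonal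
orthogonal group is isometric and distances are attained on orbits.

Lifting points of a geodesic one after the other gives equality in the triangle inequality, hence a
straight segment from L. Regularity makes the stabilizer of L trivial, so the midpoint determines
the lift. Geodesics from [L] to [M] are therefore the curves [L + uV] with V = MP - L and P optimal
(`isGeodesic_cls_iff`), and optimality of P makes V horizontal.

For horizontal D the pairing of D with N - NO is quadratic in 1 - O, while ‖L - LO‖² is at least
c²‖1 - O‖² by regularity. Hence short horizontal segments minimize, and the squared distance from [L
+ uV] to [L + uW] is u²‖V - W‖² up to O(u⁴). So angles of geodesics are Euclidean angles, every
horizontal unit vector is a direction, and the cone is 𝒱(L). `IsTangentModel` isolates what this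
argument needs; `isTangentModel` verifies it.

Uniqueness of the geodesic now means that MP is the same for all optimal P. The products
P_tᵀ(MᵀL)_{t,t} always agree, and the remaining freedom in P_t lies in the kernel of (LᵀM)_{t,t}. It
is invisible in MP exactly when that kernel is the kernel of the t-th block column of M, which is
the rank condition. -/

noncomputable section

namespace AdaptedBW

/-! ### Quotients of Euclidean spaces and their tangent cones -/

section TangentModel

variable {E X : Type*} [NormedAddCommGroup E] [InnerProductSpace ℝ E]

/-- `q : E → X` is a submetry with attained distances, and near `L` the geometry of `X` is, to
first order, that of the space `H` of horizontal vectors at `L`. -/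
structure IsTangentModel (δ : X → X → ℝ) (q : E → X) (L : E) (H : Submodule ℝ E) : Prop where
  dist_le : ∀ x y, δ (q x) (q y) ≤ ‖x - y‖
  exists_lift : ∀ x ξ, ∃ y, q y = ξ ∧ ‖x - y‖ = δ (q x) ξ
  horizontal : ∀ V, δ (q L) (q (L + V)) = ‖V‖ → V ∈ H
  radial : ∀ V ∈ H, ∀ᶠ u : ℝ in 𝓝[>] 0, δ (q L) (q (L + u • V)) = u * ‖V‖
  conical : ∀ V ∈ H, ∀ W ∈ H,
    Tendsto (fun u : ℝ => δ (q (L + u • V)) (q (L + u • W)) ^ 2 / u ^ 2) (𝓝[>] 0)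
      (𝓝 (‖V - W‖ ^ 2))
  nonbranching : ∀ V W, δ (q L) (q (L + V)) = ‖V‖ → δ (q L) (q (L + W)) = ‖W‖ →
    q (L + (1 / 2 : ℝ) • V) = q (L + (1 / 2 : ℝ) • W) → V = W

theorem tendsto_innerProductAngle {α : Type*} {l : Filter α} {f g : α → E} {v w : E}
    (hf : Tendsto f l (𝓝 v)) (hg : Tendsto g l (𝓝 w)) (hv : v ≠ 0) (hw : w ≠ 0) :
    Tendsto (fun n => InnerProductGeometry.angle (f n) (g n)) l
      (𝓝 (InnerProductGeometry.angle v w)) := by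
  have h1 : Tendsto (fun n => inner ℝ (f n) (g n) / (‖f n‖ * ‖g n‖)) l
      (𝓝 (inner ℝ v w / (‖v‖ * ‖w‖))) :=
    (hf.inner hg).div (hf.norm.mul hg.norm)
      (mul_ne_zero (norm_ne_zero_iff.2 hv) (norm_ne_zero_iff.2 hw))
  exact (Real.continuous_arccos.tendsto _).comp h1

namespace IsTangentModel

variable {δ : X → X → ℝ} {q : E → X} {L : E} {H : Submodule ℝ E}

/-! ### Metric properties of the quotient -/

theorem surjective (h : IsTangentModel δ q L H) (ξ : X) : ∃ y, q y = ξ :=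
  let ⟨y, hy, _⟩ := h.exists_lift L ξ
  ⟨y, hy⟩

theorem nonneg (h : IsTangentModel δ q L H) (ξ ζ : X) : 0 ≤ δ ξ ζ := by
  obtain ⟨x, rfl⟩ := h.surjective ξ
  obtain ⟨y, rfl, hy⟩ := h.exists_lift x ζ
  exact hy ▸ norm_nonneg _

theorem dist_self (h : IsTangentModel δ q L H) (ξ : X) : δ ξ ξ = 0 := by
  obtain ⟨x, rfl⟩ := h.surjective ξ
  exact le_antisymm ((h.dist_le x x).trans (by simp)) (h.nonneg _ _)

theorem dist_comm_le (h : IsTangentModel δ q L H) (ξ ζ : X) : δ ζ ξ ≤ δ ξ ζ := by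
  obtain ⟨x, rfl⟩ := h.surjective ξ
  obtain ⟨y, rfl, hy⟩ := h.exists_lift x ζ
  exact (h.dist_le y x).trans (by rw [← hy, norm_sub_rev])

theorem dist_comm (h : IsTangentModel δ q L H) (ξ ζ : X) : δ ξ ζ = δ ζ ξ :=
  le_antisymm (h.dist_comm_le _ _) (h.dist_comm_le _ _)

theorem dist_triangle (h : IsTangentModel δ q L H) (ξ ζ χ : X) : δ ξ χ ≤ δ ξ ζ + δ ζ χ := by
  obtain ⟨x, rfl⟩ := h.surjective ξ
  obtain ⟨y, rfl, hy⟩ := h.exists_lift x ζ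
  obtain ⟨z, rfl, hz⟩ := h.exists_lift y χ
  refine (h.dist_le x z).trans ?_
  rw [← hy, ← hz]
  exact norm_sub_le_norm_sub_add_norm_sub x y z

/-! ### Geodesics as images of minimizing segments -/

theorem dist_segment_of_le (h : IsTangentModel δ q L H) {V : E}
    (hV : δ (q L) (q (L + V)) = ‖V‖) {u v : ℝ} (hu : 0 ≤ u) (huv : u ≤ v) (hv : v ≤ 1) :
    δ (q (L + u • V)) (q (L + v • V)) = (v - u) * ‖V‖ := by
  have key : ∀ a b : ℝ, a ≤ b → δ (q (L + a • V)) (q (L + b • V)) ≤ (b - a) * ‖V‖ := by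
    intro a b hab
    refine (h.dist_le _ _).trans_eq ?_
    rw [add_sub_add_left_eq_sub, ← sub_smul, norm_smul, Real.norm_eq_abs, abs_sub_comm,
      abs_of_nonneg (sub_nonneg.2 hab)]
  -- If the middle piece were shorter, the three pieces would join the endpoints by a path shorter
  -- than ‖V‖.
  refine le_antisymm (key u v huv) ?_
  have h1 := h.dist_triangle (q L) (q (L + u • V)) (q (L + V))
  have h2 := h.dist_triangle (q (L + u • V)) (q (L + v • V)) (q (L + V))
  have h3 := key 0 u hu
  have h4 := key v 1 hv
  simp only [zero_smul, add_zero, one_smul] at h3 h4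
  rw [hV] at h1
  linarith

theorem dist_segment (h : IsTangentModel δ q L H) {V : E}
    (hV : δ (q L) (q (L + V)) = ‖V‖) (u v : I) :
    δ (q (L + (u : ℝ) • V)) (q (L + (v : ℝ) • V)) = |(u : ℝ) - v| * ‖V‖ := by
  rcases le_total (u : ℝ) v with huv | huv
  · rw [h.dist_segment_of_le hV u.2.1 huv v.2.2, abs_sub_comm, abs_of_nonneg (sub_nonneg.2 huv)]
  · rw [h.dist_comm, h.dist_segment_of_le hV v.2.1 huv u.2.2, abs_of_nonneg (sub_nonneg.2 huv)]

theorem isGeodesic_segment (h : IsTangentModel δ q L H) {V : E}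
    (hV : δ (q L) (q (L + V)) = ‖V‖) :
    IsGeodesic δ (q L) (q (L + V)) fun u => q (L + (u : ℝ) • V) :=
  ⟨by simp, by simp, fun u v => by rw [h.dist_segment hV, hV]⟩

/-- The points γ s, γ u and η are lifted successively, each lift starting from the previous one. The
legs have total length D and the endpoints are at distance at least D, so every triangle inequality
is an equality and strict convexity puts the lifts on one segment. -/
theorem exists_lift_two (h : IsTangentModel δ q L H) {η : X} {γ : I → X}
    (hγ : IsGeodesic δ (q L) η γ) {s u : I} (hsu : s ≤ u) :
    ∃ V, q (L + V) = η ∧ ‖V‖ = δ (q L) η ∧ γ s = q (L + (s : ℝ) • V) ∧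
      γ u = q (L + (u : ℝ) • V) := by
  obtain ⟨h0, h1, hd⟩ := hγ
  have hsu' : (s : ℝ) ≤ u := hsu
  set D := δ (q L) η
  obtain ⟨x, hx, hLx⟩ := h.exists_lift L (γ s)
  obtain ⟨y, hy, hxy⟩ := h.exists_lift x (γ u)
  obtain ⟨z, hz, hyz⟩ := h.exists_lift y η
  rw [← h0, hd 0 s] at hLx
  rw [hx, hd s u] at hxy
  rw [hy, ← h1, hd u 1] at hyz
  have hs0 : |((0 : I) : ℝ) - s| = s := by simp [abs_of_nonneg s.2.1]
  have hsu0 : |(s : ℝ) - u| = u - s := by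
    rw [abs_sub_comm, abs_of_nonneg (sub_nonneg.2 hsu')]
  have hu0 : |(u : ℝ) - (1 : I)| = 1 - u := by
    rw [abs_sub_comm, Set.Icc.coe_one, abs_of_nonneg (sub_nonneg.2 u.2.2)]
  rw [hs0] at hLx
  rw [hsu0] at hxy
  rw [hu0] at hyz
  have hLz : D ≤ ‖L - z‖ := by
    have := h.dist_le L z
    rwa [hz] at this
  have t1 := norm_sub_le_norm_sub_add_norm_sub L x z
  have t2 := norm_sub_le_norm_sub_add_norm_sub x y z
  have t3 := norm_sub_le_norm_sub_add_norm_sub L y z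
  have t4 := norm_sub_le_norm_sub_add_norm_sub L x y
  have hD : ‖L - z‖ = D := by linarith
  have ex : x = AffineMap.lineMap L z (s : ℝ) := by
    refine eq_lineMap_of_dist_eq_mul_of_dist_eq_mul ?_ ?_
    · rw [dist_eq_norm, dist_eq_norm, hLx, hD]
    · rw [dist_eq_norm, dist_eq_norm, hD]; linarith
  have ey : y = AffineMap.lineMap L z (u : ℝ) := by
    refine eq_lineMap_of_dist_eq_mul_of_dist_eq_mul ?_ ?_
    · rw [dist_eq_norm, dist_eq_norm, hD]; linarith
    · rw [dist_eq_norm, dist_eq_norm, hyz, hD]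
  refine ⟨z - L, by rw [add_sub_cancel, hz], by rw [norm_sub_rev, hD], ?_, ?_⟩
  · rw [← hx, ex, AffineMap.lineMap_apply_module', add_comm]
  · rw [← hy, ey, AffineMap.lineMap_apply_module', add_comm]

/-- A lift through two times depends a priori on those times. Taking 1/2 as one of them makes all
these lifts share their midpoint class, and `nonbranching` then makes them equal. -/
theorem exists_eq_segment (h : IsTangentModel δ q L H) {η : X} {γ : I → X}
    (hγ : IsGeodesic δ (q L) η γ) :
    ∃ V, q (L + V) = η ∧ ‖V‖ = δ (q L) η ∧ γ = fun u : I => q (L + (u : ℝ) • V) := by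
  let c : I := ⟨1 / 2, by norm_num, by norm_num⟩
  obtain ⟨V, h1, h2, h3, -⟩ := h.exists_lift_two hγ (le_refl c)
  refine ⟨V, h1, h2, funext fun u => ?_⟩
  have : ∃ W, q (L + W) = η ∧ ‖W‖ = δ (q L) η ∧ γ c = q (L + (c : ℝ) • W) ∧
      γ u = q (L + (u : ℝ) • W) := by
    rcases le_total c u with hu | hu
    · exact h.exists_lift_two hγ hu
    · obtain ⟨W, a, b, c, d⟩ := h.exists_lift_two hγ hu
      exact ⟨W, a, b, d, c⟩
  obtain ⟨W, k1, k2, k3, k4⟩ := this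
  have : V = W := h.nonbranching V W (by rw [h1, h2]) (by rw [k1, k2]) (by
    rw [h3] at k3; exact k3)
  rw [this, k4]

/-- The geodesics that start at `q L` are the images of the minimizing segments. -/
theorem isGeodesic_iff (h : IsTangentModel δ q L H) {η : X} {γ : I → X} :
    IsGeodesic δ (q L) η γ ↔
      ∃ V, q (L + V) = η ∧ ‖V‖ = δ (q L) η ∧ γ = fun u : I => q (L + (u : ℝ) • V) := by
  refine ⟨h.exists_eq_segment, ?_⟩
  rintro ⟨V, rfl, hV, rfl⟩
  exact h.isGeodesic_segment hV.symm

theorem tendsto_val_nhdsGT : Tendsto (fun u : I => (u : ℝ)) (𝓝[>] 0) (𝓝[>] 0) := by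
  refine tendsto_nhdsWithin_iff.2 ⟨?_, ?_⟩
  · exact (continuous_subtype_val.tendsto (0 : I)).mono_left nhdsWithin_le_nhds
  · filter_upwards [self_mem_nhdsWithin] with u hu using hu

instance nhdsGT_unitInterval_neBot : (𝓝[>] (0 : I)).NeBot :=
  nhdsGT_neBot_of_exists_gt ⟨1, zero_lt_one⟩

/-- If the two curves agree, the quotient in `conical` vanishes identically, but its limit is ‖V -
W‖². -/
theorem eq_of_segment_eq (h : IsTangentModel δ q L H) {V W : E} (hV : V ∈ H) (hW : W ∈ H)
    (hVW : (fun u : I => q (L + (u : ℝ) • V)) = fun u : I => q (L + (u : ℝ) • W)) : V = W := by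
  have h1 := (h.conical V hV W hW).comp tendsto_val_nhdsGT
  have h2 : Tendsto (fun _ : I => (0 : ℝ)) (𝓝[>] 0) (𝓝 (‖V - W‖ ^ 2)) := by
    refine h1.congr fun u => ?_
    have h3 : q (L + (u : ℝ) • V) = q (L + (u : ℝ) • W) := congrFun hVW u
    simp [h3, h.dist_self]
  have h3 := tendsto_nhds_unique h2 tendsto_const_nhds
  simpa [sub_eq_zero] using h3

/-- The speed of the geodesic is constant, and for small parameters it is ‖V‖ by `radial`. -/
theorem dist_eq_norm_of_isGeodesic (h : IsTangentModel δ q L H) {V : E} (hV : V ∈ H)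
    (hγ : IsGeodesic δ (q L) (q (L + V)) fun u => q (L + (u : ℝ) • V)) :
    δ (q L) (q (L + V)) = ‖V‖ := by
  obtain ⟨u, hu, hu0⟩ := ((tendsto_val_nhdsGT.eventually (h.radial V hV)).and
    self_mem_nhdsWithin).exists
  have hu' : (0 : ℝ) < u := hu0
  have := hγ.2.2 0 u
  simp only [Set.Icc.coe_zero, zero_smul, add_zero, zero_sub, abs_neg, abs_of_pos hu', hu] at this
  exact (mul_left_cancel₀ hu'.ne' this).symm

theorem exists_vec (h : IsTangentModel δ q L H) (γ : NonconstGeodesic δ (q L)) :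
    ∃ V : H, V ≠ 0 ∧ γ.toFun = fun u : I => q (L + (u : ℝ) • (V : E)) := by
  obtain ⟨V, h1, h2, h3⟩ := h.exists_eq_segment γ.isGeodesic
  refine ⟨⟨V, h.horizontal V (by rw [h1, h2])⟩, ?_, h3⟩
  intro h0
  have h4 : V = 0 := congrArg Subtype.val h0
  have := γ.speed_pos
  rw [← h2, h4, norm_zero] at this
  exact lt_irrefl _ this

/-- The horizontal vector of a geodesic. -/
def vec (h : IsTangentModel δ q L H) (γ : NonconstGeodesic δ (q L)) : H := (h.exists_vec γ).choose

theorem vec_ne_zero (h : IsTangentModel δ q L H) (γ : NonconstGeodesic δ (q L)) : h.vec γ ≠ 0 :=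
  (h.exists_vec γ).choose_spec.1

theorem toFun_eq (h : IsTangentModel δ q L H) (γ : NonconstGeodesic δ (q L)) :
    γ.toFun = fun u : I => q (L + (u : ℝ) • (h.vec γ : E)) :=
  (h.exists_vec γ).choose_spec.2

theorem vec_eq (h : IsTangentModel δ q L H) (γ : NonconstGeodesic δ (q L)) {V : H}
    (hV : γ.toFun = fun u : I => q (L + (u : ℝ) • (V : E))) : h.vec γ = V :=
  Subtype.ext (h.eq_of_segment_eq (h.vec γ).2 V.2 (by rw [← h.toFun_eq γ, hV]))

/-! ### Angles of geodesics are Euclidean angles -/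

theorem tendsto_comparisonCos (h : IsTangentModel δ q L H) {V W : E} (hV : V ∈ H) (hW : W ∈ H)
    (hV0 : V ≠ 0) (hW0 : W ≠ 0) :
    Tendsto (fun u : I => comparisonCos δ (q L) (q (L + (u : ℝ) • V)) (q (L + (u : ℝ) • W)))
      (𝓝[>] 0) (𝓝 (inner ℝ V W / (‖V‖ * ‖W‖))) := by
  have hV1 : ‖V‖ ≠ 0 := norm_ne_zero_iff.2 hV0
  have hW1 : ‖W‖ ≠ 0 := norm_ne_zero_iff.2 hW0
  have key : Tendsto (fun u : ℝ => (‖V‖ ^ 2 + ‖W‖ ^ 2 -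
      δ (q (L + u • V)) (q (L + u • W)) ^ 2 / u ^ 2) / (2 * ‖V‖ * ‖W‖)) (𝓝[>] 0)
      (𝓝 (inner ℝ V W / (‖V‖ * ‖W‖))) := by
    have h1 := ((h.conical V hV W hW).const_sub (‖V‖ ^ 2 + ‖W‖ ^ 2)).div_const (2 * ‖V‖ * ‖W‖)
    convert h1 using 2
    rw [norm_sub_sq_real]
    field_simp
    ring
  refine (key.comp tendsto_val_nhdsGT).congr' ?_
  filter_upwards [tendsto_val_nhdsGT.eventually (h.radial V hV),
    tendsto_val_nhdsGT.eventually (h.radial W hW), self_mem_nhdsWithin] with u h1 h2 h3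
  have hu : (u : ℝ) ≠ 0 := ne_of_gt h3
  simp only [Function.comp, comparisonCos, h1, h2]
  field_simp

theorem angle_eq (h : IsTangentModel δ q L H) (γ η : NonconstGeodesic δ (q L)) :
    angle γ η = InnerProductGeometry.angle (h.vec γ) (h.vec η) := by
  have h1 := h.tendsto_comparisonCos (h.vec γ).2 (h.vec η).2
    (fun h0 => h.vec_ne_zero γ (Subtype.ext h0)) (fun h0 => h.vec_ne_zero η (Subtype.ext h0))
  rw [angle, InnerProductGeometry.angle]
  congr 1
  refine Tendsto.limUnder_eq ?_
  simp only [h.toFun_eq γ, h.toFun_eq η]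
  exact h1

/-- The unit vector of a geodesic. -/
def unitVec (h : IsTangentModel δ q L H) (γ : NonconstGeodesic δ (q L)) : H :=
  ‖h.vec γ‖⁻¹ • h.vec γ

theorem norm_unitVec (h : IsTangentModel δ q L H) (γ : NonconstGeodesic δ (q L)) :
    ‖h.unitVec γ‖ = 1 := by
  have := norm_ne_zero_iff.2 (h.vec_ne_zero γ)
  rw [unitVec, norm_smul, norm_inv, norm_norm, inv_mul_cancel₀ this]

theorem angle_eq_unitVec (h : IsTangentModel δ q L H) (γ η : NonconstGeodesic δ (q L)) :
    angle γ η = InnerProductGeometry.angle (h.unitVec γ) (h.unitVec η) := by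
  rw [h.angle_eq, unitVec, unitVec, InnerProductGeometry.angle_smul_left_of_pos,
    InnerProductGeometry.angle_smul_right_of_pos]
  · exact inv_pos.2 (norm_pos_iff.2 (h.vec_ne_zero η))
  · exact inv_pos.2 (norm_pos_iff.2 (h.vec_ne_zero γ))

/-- A chord of the unit sphere is at most its arc: 2 - 2 cos θ ≤ θ². Angle-Cauchy sequences of
geodesics thus become norm-Cauchy sequences of unit vectors. -/
theorem dist_unitVec_le (h : IsTangentModel δ q L H) (γ η : NonconstGeodesic δ (q L)) :
    dist (h.unitVec γ) (h.unitVec η) ≤ angle γ η := by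
  have h0 : 0 ≤ angle γ η := Real.arccos_nonneg _
  refine abs_le_of_sq_le_sq' ?_ h0 |>.2
  have h1 := InnerProductGeometry.norm_sub_sq_eq_norm_sq_add_norm_sq_sub_two_mul_norm_mul_norm_mul_cos_angle
    (h.unitVec γ) (h.unitVec η)
  rw [← h.angle_eq_unitVec, h.norm_unitVec, h.norm_unitVec] at h1
  have h2 := Real.one_sub_sq_div_two_le_cos (x := angle γ η)
  rw [dist_eq_norm]
  nlinarith

/-! ### Space of directions and tangent cone -/

variable [CompleteSpace H]

theorem exists_tendsto_unitVec (h : IsTangentModel δ q L H) (s : CauchyGeodesics δ (q L)) :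
    ∃ v : H, Tendsto (fun n => h.unitVec (s.1 n)) atTop (𝓝 v) := by
  refine cauchySeq_tendsto_of_complete (Metric.cauchySeq_iff.2 fun ε hε => ?_)
  obtain ⟨N, hN⟩ := s.2 ε hε
  exact ⟨N, fun m hm n hn => (h.dist_unitVec_le _ _).trans_lt (hN m hm n hn)⟩

/-- The unit vector of a Cauchy sequence of geodesics. -/
def limVec (h : IsTangentModel δ q L H) (s : CauchyGeodesics δ (q L)) : H :=
  (h.exists_tendsto_unitVec s).choose

theorem tendsto_limVec (h : IsTangentModel δ q L H) (s : CauchyGeodesics δ (q L)) :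
    Tendsto (fun n => h.unitVec (s.1 n)) atTop (𝓝 (h.limVec s)) :=
  (h.exists_tendsto_unitVec s).choose_spec

theorem norm_limVec (h : IsTangentModel δ q L H) (s : CauchyGeodesics δ (q L)) :
    ‖h.limVec s‖ = 1 := by
  have h1 := (h.tendsto_limVec s).norm
  simp only [h.norm_unitVec] at h1
  exact (tendsto_nhds_unique h1 tendsto_const_nhds)

theorem limVec_ne_zero (h : IsTangentModel δ q L H) (s : CauchyGeodesics δ (q L)) :
    h.limVec s ≠ 0 := by
  intro h0
  have := h.norm_limVec s
  simp [h0] at this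

theorem tendsto_angle (h : IsTangentModel δ q L H) (s s' : CauchyGeodesics δ (q L)) :
    Tendsto (fun n => angle (s.1 n) (s'.1 n)) atTop
      (𝓝 (InnerProductGeometry.angle (h.limVec s) (h.limVec s'))) := by
  rw [show (fun n => angle (s.1 n) (s'.1 n)) = fun n =>
    InnerProductGeometry.angle (h.unitVec (s.1 n)) (h.unitVec (s'.1 n)) from
    funext fun n => h.angle_eq_unitVec _ _]
  exact tendsto_innerProductAngle (h.tendsto_limVec s) (h.tendsto_limVec s')
    (h.limVec_ne_zero s) (h.limVec_ne_zero s')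

theorem limVec_eq_iff (h : IsTangentModel δ q L H) (s s' : CauchyGeodesics δ (q L)) :
    h.limVec s = h.limVec s' ↔ Tendsto (fun n => angle (s.1 n) (s'.1 n)) atTop (𝓝 0) := by
  constructor
  · intro he
    have h1 := h.tendsto_angle s s'
    rwa [he, InnerProductGeometry.angle_self (h.limVec_ne_zero s')] at h1
  · intro h0
    have h1 := tendsto_nhds_unique (h.tendsto_angle s s') h0
    rw [InnerProductGeometry.angle, Real.arccos_eq_zero, h.norm_limVec, h.norm_limVec] at h1
    refine (inner_eq_one_iff_of_norm_eq_one (𝕜 := ℝ) (h.norm_limVec s) (h.norm_limVec s')).1 ?_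
    refine le_antisymm ?_ (by simpa using h1)
    have := real_inner_le_norm (h.limVec s) (h.limVec s')
    simpa [h.norm_limVec] using this

/-- The unit vector of a direction. -/
def dirVec (h : IsTangentModel δ q L H) : Directions δ (q L) → H :=
  Quot.lift h.limVec fun s s' hs => (h.limVec_eq_iff s s').2 hs

/-- Angles of directions are computed with chosen representatives; the limit vector does not depend
on that choice. -/
theorem limVec_out (h : IsTangentModel δ q L H) (ξ : Directions δ (q L)) :
    h.limVec ξ.out = h.dirVec ξ := by
  conv_rhs => rw [← Quot.out_eq ξ]
  rfl

theorem norm_dirVec (h : IsTangentModel δ q L H) (ξ : Directions δ (q L)) : ‖h.dirVec ξ‖ = 1 := by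
  rw [← limVec_out, norm_limVec]

theorem dirVec_injective (h : IsTangentModel δ q L H) : Function.Injective h.dirVec := by
  rintro ⟨s⟩ ⟨s'⟩ hs
  exact Quot.sound ((h.limVec_eq_iff s s').1 hs)

theorem dirVec_direction (h : IsTangentModel δ q L H) (γ : NonconstGeodesic δ (q L)) :
    h.dirVec γ.direction = h.unitVec γ :=
  tendsto_nhds_unique (h.tendsto_limVec ⟨fun _ => γ, _⟩) tendsto_const_nhds

/-- A short enough multiple of v spans a minimizing segment by `radial`, so v already comes from a
geodesic and the completion adds no direction. -/
theorem exists_dirVec_eq (h : IsTangentModel δ q L H) (v : H) (hv : ‖v‖ = 1) :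
    ∃ ξ, h.dirVec ξ = v := by
  obtain ⟨u, hu, hu0⟩ := ((h.radial v v.2).and self_mem_nhdsWithin).exists
  have hu0 : 0 < u := hu0
  have hn : ‖u • (v : E)‖ = u * ‖(v : E)‖ := by
    rw [norm_smul, Real.norm_eq_abs, abs_of_pos hu0]
  have hv' : ‖(v : E)‖ = 1 := hv
  have hg := h.isGeodesic_segment (hu.trans hn.symm)
  have h1 : q (L + ((1 : I) : ℝ) • u • (v : E)) = q (L + u • (v : E)) := by simp
  let γ : NonconstGeodesic δ (q L) := ⟨fun t => q (L + (t : ℝ) • u • (v : E)),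
    by rw [h1]; exact hg, by rw [h1, hu, hv', mul_one]; exact hu0⟩
  refine ⟨γ.direction, ?_⟩
  have h2 : h.vec γ = u • v := h.vec_eq γ rfl
  rw [dirVec_direction, unitVec, h2, norm_smul, hv, mul_one, smul_smul, Real.norm_eq_abs,
    abs_of_pos hu0, inv_mul_cancel₀ hu0.ne', one_smul]

theorem directions_angle_eq (h : IsTangentModel δ q L H) (ξ ζ : Directions δ (q L)) :
    ξ.angle ζ = InnerProductGeometry.angle (h.dirVec ξ) (h.dirVec ζ) := by
  rw [Directions.angle, (h.tendsto_angle _ _).limUnder_eq, limVec_out, limVec_out]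

/-- The horizontal vector of a point of the tangent cone. -/
def coneVec (h : IsTangentModel δ q L H) : TangentCone δ (q L) → H
  | .tip => 0
  | .ray ξ r _ => r • h.dirVec ξ

theorem norm_coneVec_sub (h : IsTangentModel δ q L H) (x y : TangentCone δ (q L)) :
    ‖h.coneVec x - h.coneVec y‖ = x.dist y := by
  rcases x with _ | ⟨ξ, r, hr⟩ <;> rcases y with _ | ⟨ζ, s, hs⟩
  · simp [coneVec, TangentCone.dist]
  · simp [coneVec, TangentCone.dist, norm_smul, h.norm_dirVec, abs_of_pos hs]
  · simp [coneVec, TangentCone.dist, norm_smul, h.norm_dirVec, abs_of_pos hr]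
  · rw [TangentCone.dist, coneVec, coneVec, ← Real.sqrt_sq (norm_nonneg _), norm_sub_sq_real,
      h.directions_angle_eq, InnerProductGeometry.cos_angle, inner_smul_left, inner_smul_right,
      norm_smul, norm_smul, h.norm_dirVec, h.norm_dirVec, Real.norm_eq_abs, Real.norm_eq_abs,
      abs_of_pos hr, abs_of_pos hs]
    congr 1
    simp
    ring

theorem coneVec_bijective (h : IsTangentModel δ q L H) : Function.Bijective h.coneVec := by
  constructor
  · have hray : ∀ ξ r, 0 < r → ‖r • h.dirVec ξ‖ = r := fun ξ r hr => by
      rw [norm_smul, h.norm_dirVec, mul_one, Real.norm_eq_abs, abs_of_pos hr]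
    rintro (_ | ⟨ξ, r, hr⟩) (_ | ⟨ζ, s, hs⟩) hxy
    · rfl
    · exact absurd (congrArg norm hxy) (by
        simp only [coneVec, hray _ _ hs, norm_zero]; exact hs.ne)
    · exact absurd (congrArg norm hxy) (by
        simp only [coneVec, hray _ _ hr, norm_zero]; exact hr.ne')
    · simp only [coneVec] at hxy
      have hrs : r = s := by rw [← hray ξ r hr, hxy, hray ζ s hs]
      subst hrs
      have := h.dirVec_injective (smul_right_injective _ hr.ne' hxy)
      rw [this]
  · intro v
    by_cases hv : v = 0
    · exact ⟨.tip, hv.symm⟩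
    · have hv' : ‖v‖ ≠ 0 := norm_ne_zero_iff.2 hv
      obtain ⟨ξ, hξ⟩ := h.exists_dirVec_eq (‖v‖⁻¹ • v) (by
        rw [norm_smul, norm_inv, norm_norm, inv_mul_cancel₀ hv'])
      exact ⟨.ray ξ ‖v‖ (norm_pos_iff.2 hv), by
        rw [coneVec, hξ, smul_smul, mul_inv_cancel₀ hv', one_smul]⟩

theorem coneVec_velocity (h : IsTangentModel δ q L H) (V : H)
    (hγ : IsGeodesic δ (q L) (q (L + V)) fun u => q (L + (u : ℝ) • (V : E))) :
    h.coneVec (velocity _ hγ) = V := by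
  have hV := h.dist_eq_norm_of_isGeodesic V.2 hγ
  unfold velocity
  split_ifs with h0
  · rw [coneVec, dirVec_direction, unitVec, h.vec_eq (V := V) _ rfl, hV, smul_smul,
      Submodule.coe_norm, mul_inv_cancel₀ (hV ▸ h0.ne'), one_smul]
  · rw [hV] at h0
    have : ‖(V : E)‖ = 0 := le_antisymm (not_lt.1 h0) (norm_nonneg _)
    exact (Subtype.ext (norm_eq_zero.1 this)).symm

end IsTangentModel

end TangentModel

/-! ### Bicausal couplings of the Gaussian basis -/

/-- A σ-algebra that is independent of the conditioning σ-algebra can drop the conditioning. -/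
theorem indep_of_condIndep {Ω : Type*} {m' m₁ m₂ m : MeasurableSpace Ω} {mΩ : MeasurableSpace Ω}
    [StandardBorelSpace Ω] {μ : Measure Ω} [IsProbabilityMeasure μ] (hm' : m' ≤ mΩ)
    (hm₁ : m₁ ≤ mΩ) (hm₂ : m₂ ≤ mΩ) (h : CondIndep m' m₁ m₂ hm' μ) (hm : m ≤ m₁)
    (hi : Indep m m' μ) : Indep m m₂ μ := by
  rw [condIndep_iff m' m₁ m₂ hm' hm₁ hm₂] at h
  rw [Indep_iff]
  intro A B hA hB
  have hA' := hm₁ A (hm A hA)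
  have hB' := hm₂ B hB
  -- The conditional probability of A is constant, so the conditional product formula can be
  -- integrated.
  have h1 : μ⟦A | m'⟧ =ᵐ[μ] fun _ => μ.real A := by
    have := condExp_indep_eq (hm.trans hm₁) hm'
      (stronglyMeasurable_const.indicator hA : StronglyMeasurable[m] (A.indicator fun _ => (1 : ℝ)))
      hi
    simpa [integral_indicator hA', Measure.real] using this
  have h2 : μ⟦A ∩ B | m'⟧ =ᵐ[μ] fun z => μ.real A * (μ⟦B | m'⟧) z := by
    filter_upwards [h A B (hm A hA) hB, h1] with z hz hz'
    rw [hz, Pi.mul_apply, hz']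
  have h3 : μ.real (A ∩ B) = μ.real A * μ.real B := by
    have e := integral_congr_ae h2
    rw [integral_condExp hm', integral_const_mul, integral_condExp hm'] at e
    simpa [integral_indicator (hA'.inter hB'), integral_indicator hB'] using e
  rw [← ENNReal.toReal_eq_toReal_iff' (measure_ne_top _ _)
    (ENNReal.mul_ne_top (measure_ne_top _ _) (measure_ne_top _ _)), ENNReal.toReal_mul]
  exact h3

/-- Conditional independence holds when the second σ-algebra is almost surely contained in the
conditioning σ-algebra. -/
theorem condIndep_of_ae_le {Ω : Type*} {m' m₁ m₂ : MeasurableSpace Ω} {mΩ : MeasurableSpace Ω}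
    [StandardBorelSpace Ω] {μ : Measure Ω} [IsProbabilityMeasure μ] (hm' : m' ≤ mΩ)
    (hm₁ : m₁ ≤ mΩ) (hm₂ : m₂ ≤ mΩ)
    (h : ∀ B, MeasurableSet[m₂] B → ∃ B', MeasurableSet[m'] B' ∧ B =ᵐ[μ] B') :
    CondIndep m' m₁ m₂ hm' μ := by
  rw [condIndep_iff m' m₁ m₂ hm' hm₁ hm₂]
  intro A B hA hB
  obtain ⟨B', hB', hBB'⟩ := h B hB
  have hA' := hm₁ A hA
  have h1 : μ⟦B | m'⟧ =ᵐ[μ] B'.indicator fun _ => (1 : ℝ) := by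
    refine (condExp_congr_ae (indicator_ae_eq_of_ae_eq_set hBB')).trans ?_
    rw [condExp_of_stronglyMeasurable hm' (stronglyMeasurable_const.indicator hB')
      ((integrable_const _).indicator (hm' _ hB'))]
  have h2 : μ⟦A ∩ B | m'⟧ =ᵐ[μ] B'.indicator (μ⟦A | m'⟧) := by
    have e : (A ∩ B).indicator (fun _ => (1 : ℝ)) =ᵐ[μ]
        B'.indicator (A.indicator fun _ => (1 : ℝ)) := by
      rw [Set.inter_comm, ← Set.indicator_indicator]
      exact indicator_ae_eq_of_ae_eq_set hBB'
    exact (condExp_congr_ae e).trans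
      (condExp_indicator ((integrable_const _).indicator hA') hB')
  filter_upwards [h1, h2] with z h1 h2
  rw [h2, Pi.mul_apply, h1]
  by_cases hz : z ∈ B' <;> simp [hz]

section Gaussian

variable {T d : ℕ}

instance : IsProbabilityMeasure (gaussianLaw T d) := by
  unfold gaussianLaw; infer_instance

/-- Rotation invariance of the standard Gaussian, transported from the Euclidean space, where A is a
linear isometry. -/
theorem map_mulVec_gaussianLaw (A : Matrix (Fin d × Fin T) (Fin d × Fin T) ℝ)
    (hA : A ∈ Matrix.orthogonalGroup (Fin d × Fin T) ℝ) :
    (gaussianLaw T d).map (fun ω => A *ᵥ ω) = gaussianLaw T d := by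
  let f : EuclideanSpace ℝ (Fin d × Fin T) ≃ₗᵢ[ℝ] EuclideanSpace ℝ (Fin d × Fin T) :=
    LinearIsometryEquiv.ofSurjective
      ⟨Matrix.toEuclideanLin A, fun x => by
        rw [← sq_eq_sq₀ (norm_nonneg _) (norm_nonneg _), EuclideanSpace.real_norm_sq_eq,
          EuclideanSpace.real_norm_sq_eq]
        have h1 : (A *ᵥ x.ofLp) ⬝ᵥ (A *ᵥ x.ofLp) = x.ofLp ⬝ᵥ x.ofLp := by
          rw [Matrix.dotProduct_mulVec, Matrix.vecMul_mulVec,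
            (Matrix.mem_orthogonalGroup_iff' _ _).1 hA, Matrix.vecMul_one]
        simpa [dotProduct, sq] using h1⟩
      (by
        intro y
        refine ⟨WithLp.toLp 2 (Aᵀ *ᵥ y.ofLp), ?_⟩
        have h1 : A *ᵥ (Aᵀ *ᵥ y.ofLp) = y.ofLp := by
          rw [Matrix.mulVec_mulVec, (Matrix.mem_orthogonalGroup_iff _ _).1 hA, Matrix.one_mulVec]
        simpa using congrArg (WithLp.toLp 2) h1)
  have h1 := stdGaussian_map f
  rw [← map_pi_eq_stdGaussian] at h1
  have hm : Measurable (WithLp.toLp 2 : (Fin d × Fin T → ℝ) → _) := by fun_prop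
  have hf : Measurable f := f.continuous.measurable
  have ho : Measurable (WithLp.ofLp : EuclideanSpace ℝ (Fin d × Fin T) → _) := by fun_prop
  have h2 := congrArg (Measure.map WithLp.ofLp) h1
  rw [Measure.map_map hf hm, Measure.map_map ho (hf.comp hm), Measure.map_map ho hm] at h2
  change Measure.map (fun ω => A *ᵥ ω) _ = Measure.map (fun ω => ω) _ at h2
  rwa [Measure.map_id'] at h2

theorem measurePreserving_coord (a : Fin d × Fin T) :
    MeasurePreserving (fun ω : Path T d => ω a) (gaussianLaw T d) (gaussianReal 0 1) :=
  measurePreserving_eval (fun _ : Fin d × Fin T => gaussianReal 0 1) a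

theorem integral_gaussianLaw_coord (a : Fin d × Fin T) : ∫ ω, ω a ∂(gaussianLaw T d) = 0 := by
  have := integral_map (μ := gaussianLaw T d) (φ := fun ω => ω a) (f := fun x : ℝ => x)
    (measurePreserving_coord a).measurable.aemeasurable (by fun_prop)
  rw [(measurePreserving_coord a).map_eq, integral_id_gaussianReal] at this
  exact this.symm

theorem integral_gaussianLaw_mul (a b : Fin d × Fin T) :
    ∫ ω, ω a * ω b ∂(gaussianLaw T d) = if a = b then 1 else 0 := by
  split_ifs with hab
  · subst hab
    have h1 := variance_id_gaussianReal (μ := 0) (v := 1)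
    rw [variance_of_integral_eq_zero (by fun_prop) (by simp [integral_id_gaussianReal])] at h1
    have := integral_map (μ := gaussianLaw T d) (φ := fun ω => ω a) (f := fun x : ℝ => x ^ 2)
      (measurePreserving_coord a).measurable.aemeasurable (by fun_prop)
    rw [(measurePreserving_coord a).map_eq] at this
    simp only [id] at h1
    rw [h1] at this
    simpa [sq] using this.symm
  · have hi : iIndepFun (fun (i : Fin d × Fin T) (ω : Path T d) => ω i) (gaussianLaw T d) :=
      iIndepFun_pi (X := fun _ x => x) fun _ => by fun_prop
    have := (hi.indepFun hab).integral_fun_mul_eq_mul_integral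
      (measurable_pi_apply a).aestronglyMeasurable (measurable_pi_apply b).aestronglyMeasurable
    rw [this, integral_gaussianLaw_coord, zero_mul]

theorem comap_gaussianFiltration {Ω : Type*} (X : Ω → Path T d) (s : Fin T) :
    (gaussianFiltration T d s).comap X =
      ⨆ k ∈ {k : Fin d × Fin T | k.2 ≤ s},
        MeasurableSpace.comap (fun z => X z k) inferInstance := by
  change MeasurableSpace.comap X (⨆ k : {k : Fin d × Fin T // k.2 ≤ s}, _) = _
  rw [MeasurableSpace.comap_iSup, iSup_subtype]
  simp only [MeasurableSpace.comap_comp]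
  rfl

theorem comap_coord_le {Ω : Type*} (X : Ω → Path T d) (a : Fin d × Fin T) :
    MeasurableSpace.comap (fun z => X z a) inferInstance ≤
      (gaussianFiltration T d a.2).comap X := by
  rw [comap_gaussianFiltration]
  exact le_iSup₂_of_le (f := fun k (_ : k ∈ {k : Fin d × Fin T | k.2 ≤ a.2}) =>
    MeasurableSpace.comap (fun z => X z k) inferInstance) a (le_refl a.2) le_rfl

variable {Ω : Type*} [mΩ : MeasurableSpace Ω] {μ : Measure Ω} {X Y : Ω → Path T d}

theorem memLp_coord (hX : Measurable X) (hμ : μ.map X = gaussianLaw T d) (a : Fin d × Fin T) :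
    MemLp (fun z => X z a) 2 μ := by
  have h1 : MemLp (fun x : ℝ => x) 2 (gaussianReal 0 1) := memLp_id_gaussianReal 2
  have h2 : MemLp (fun ω : Path T d => ω a) 2 (gaussianLaw T d) :=
    h1.comp_measurePreserving (measurePreserving_coord a)
  exact h2.comp_measurePreserving ⟨hX, hμ⟩

theorem integrable_coord_mul (hX : Measurable X) (hXμ : μ.map X = gaussianLaw T d)
    (hY : Measurable Y) (hYμ : μ.map Y = gaussianLaw T d) (a b : Fin d × Fin T) :
    Integrable (fun z => X z a * Y z b) μ :=
  (memLp_coord hX hXμ a).integrable_mul (memLp_coord hY hYμ b)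

theorem integral_coord_mul (hX : Measurable X) (hXμ : μ.map X = gaussianLaw T d)
    (a b : Fin d × Fin T) : ∫ z, X z a * X z b ∂μ = if a = b then 1 else 0 := by
  rw [← integral_gaussianLaw_mul, ← hXμ, integral_map hX.aemeasurable]
  exact (Measurable.aestronglyMeasurable (by fun_prop))

theorem isProbabilityMeasure_of_map (hX : Measurable X) (hXμ : μ.map X = gaussianLaw T d) :
    IsProbabilityMeasure μ :=
  ⟨by
    have := measure_univ (μ := gaussianLaw T d)
    rwa [← hXμ, Measure.map_apply hX .univ] at this⟩

theorem iIndepFun_coord (hX : Measurable X) (hXμ : μ.map X = gaussianLaw T d) :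
    iIndepFun (fun a z => X z a) μ := by
  have := isProbabilityMeasure_of_map hX hXμ
  refine (iIndepFun_iff_map_fun_eq_pi_map fun a => by fun_prop).2 ?_
  change μ.map X = _
  rw [hXμ, gaussianLaw]
  congr 1
  funext a
  rw [← (measurePreserving_coord a).map_eq, ← hXμ, Measure.map_map (measurable_pi_apply a) hX]
  rfl

theorem indep_coord_filtration (hX : Measurable X) (hXμ : μ.map X = gaussianLaw T d)
    {a : Fin d × Fin T} {s : Fin T} (hs : s < a.2) :
    Indep (MeasurableSpace.comap (fun z => X z a) inferInstance)
      ((gaussianFiltration T d s).comap X) μ := by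
  rw [comap_gaussianFiltration]
  have h := indep_iSup_of_disjoint (S := {a}) (T := {k : Fin d × Fin T | k.2 ≤ s})
    (fun k => (Measurable.comap_le (by fun_prop) : MeasurableSpace.comap (fun z => X z k) _ ≤ mΩ))
    (iIndepFun_coord hX hXμ) (by simpa using hs)
  simpa using h

variable [StandardBorelSpace Ω]

/-- The later coordinate of Y is independent of the past of Y at time `a.2`. Given that past, the
past of X carries no information about it, so it is independent of the coordinate `a` of X; both are
centred. -/
theorem integral_coord_mul_eq_zero [IsProbabilityMeasure μ]
    (hX : Measurable X) (hXμ : μ.map X = gaussianLaw T d)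
    (hY : Measurable Y) (hYμ : μ.map Y = gaussianLaw T d) {a b : Fin d × Fin T} (hab : a.2 < b.2)
    (h : CondIndep ((gaussianFiltration T d a.2).comap Y)
      ((⨆ s, gaussianFiltration T d s).comap Y) ((gaussianFiltration T d a.2).comap X)
      ((MeasurableSpace.comap_mono ((gaussianFiltration T d).le a.2)).trans hY.comap_le) μ) :
    ∫ z, X z a * Y z b ∂μ = 0 := by
  have hi : Indep (MeasurableSpace.comap (fun z => Y z b) inferInstance)
      ((gaussianFiltration T d a.2).comap X) μ := by
    refine indep_of_condIndep _ ?_ ?_ h ?_ (indep_coord_filtration hY hYμ hab)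
    · exact (MeasurableSpace.comap_mono
        (iSup_le fun s => (gaussianFiltration T d).le s)).trans hY.comap_le
    · exact (MeasurableSpace.comap_mono ((gaussianFiltration T d).le a.2)).trans hX.comap_le
    · exact (comap_coord_le Y b).trans (MeasurableSpace.comap_mono (le_iSup _ _))
  have hi' : IndepFun (fun z => X z a) (fun z => Y z b) μ :=
    ((indep_of_indep_of_le_right hi (comap_coord_le X a)).symm)
  rw [hi'.integral_fun_mul_eq_mul_integral (by fun_prop) (by fun_prop)]
  have h0 : ∫ z, X z a ∂μ = 0 := by
    have := integral_map (μ := μ) (φ := X) (f := fun ω : Path T d => ω a) hX.aemeasurable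
      (Measurable.aestronglyMeasurable (by fun_prop))
    rw [← this, hXμ, integral_gaussianLaw_coord]
  rw [h0, zero_mul]

end Gaussian

/-! ### Orthogonal matrices that maximize a trace -/

section Polar

variable {n : Type*} [Fintype n] [DecidableEq n]

/-- The orthogonal matrices `O` that maximize `tr (Oᵀ A)`. -/
def IsPolarFactor (A O : Matrix n n ℝ) : Prop :=
  O ∈ Matrix.orthogonalGroup n ℝ ∧
    ∀ R ∈ Matrix.orthogonalGroup n ℝ, (Rᵀ * A).trace ≤ (Oᵀ * A).trace

theorem isCompact_orthogonalGroup :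
    IsCompact (Matrix.orthogonalGroup n ℝ : Set (Matrix n n ℝ)) := by
  have h1 : IsCompact (Set.pi Set.univ fun _ : n => Set.pi Set.univ fun _ : n =>
      Set.Icc (-1 : ℝ) 1) := isCompact_univ_pi fun _ => isCompact_univ_pi fun _ => isCompact_Icc
  refine h1.of_isClosed_subset ?_ ?_
  · have : (Matrix.orthogonalGroup n ℝ : Set (Matrix n n ℝ)) = {A | A * Aᵀ = 1} := by
      ext A
      exact Matrix.mem_orthogonalGroup_iff n ℝ
    rw [this]
    exact isClosed_eq (by fun_prop) continuous_const
  · intro A hA i _ j _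
    have := entry_norm_bound_of_unitary (𝕜 := ℝ) hA i j
    exact abs_le.1 this

theorem exists_isPolarFactor (A : Matrix n n ℝ) : ∃ O, IsPolarFactor A O := by
  obtain ⟨O, hO, hmax⟩ := isCompact_orthogonalGroup.exists_isMaxOn
    ⟨(1 : Matrix n n ℝ), one_mem (Matrix.orthogonalGroup n ℝ)⟩
    (f := fun R : Matrix n n ℝ => (Rᵀ * A).trace) (by fun_prop)
  exact ⟨O, hO, fun R hR => hmax hR⟩

theorem dotProduct_self_pos {n : Type*} [Fintype n] {x : n → ℝ} (hx : x ≠ 0) : 0 < x ⬝ᵥ x :=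
  (Finset.sum_nonneg fun i _ => mul_self_nonneg (x i)).lt_of_ne'
    fun h => hx (dotProduct_self_eq_zero.1 h)

/-- The reflection in the hyperplane orthogonal to `x`. -/
def householder (x : n → ℝ) : Matrix n n ℝ := 1 - (2 / (x ⬝ᵥ x)) • Matrix.vecMulVec x x

theorem householder_transpose (x : n → ℝ) : (householder x)ᵀ = householder x := by
  simp [householder, Matrix.transpose_sub, Matrix.transpose_vecMulVec]

theorem householder_mem (x : n → ℝ) (hx : x ≠ 0) :
    householder x ∈ Matrix.orthogonalGroup n ℝ := by
  have h0 : x ⬝ᵥ x ≠ 0 := fun h => hx (dotProduct_self_eq_zero.1 h)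
  rw [Matrix.mem_orthogonalGroup_iff]
  change householder x * (householder x)ᵀ = 1
  rw [householder_transpose, householder]
  simp only [mul_sub, sub_mul, mul_one, one_mul, smul_mul_assoc, mul_smul_comm,
    Matrix.vecMulVec_mul_vecMulVec, smul_smul, Matrix.vecMulVec_smul]
  rw [div_mul_cancel₀ _ h0, two_smul]
  simp

theorem trace_vecMulVec_mul {n : Type*} [Fintype n] (x y : n → ℝ) (B : Matrix n n ℝ) :
    (Matrix.vecMulVec x y * B).trace = y ⬝ᵥ B *ᵥ x := by
  rw [Matrix.vecMulVec_mul, Matrix.trace_vecMulVec, dotProduct_comm, Matrix.dotProduct_mulVec]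

/-- Testing maximality against the reflection in x lowers the trace by 2 xᵀBx / |x|², which
therefore cannot be negative. -/
theorem dotProduct_mulVec_nonneg_of_trace_le {B : Matrix n n ℝ}
    (hB : ∀ R ∈ Matrix.orthogonalGroup n ℝ, (Rᵀ * B).trace ≤ B.trace) (x : n → ℝ) :
    0 ≤ x ⬝ᵥ B *ᵥ x := by
  by_cases hx : x = 0
  · simp [hx]
  have h0 : 0 < x ⬝ᵥ x := dotProduct_self_pos hx
  have h1 := hB _ (householder_mem x hx)
  rw [householder_transpose, householder, sub_mul, one_mul, Matrix.trace_sub, smul_mul_assoc,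
    Matrix.trace_smul, trace_vecMulVec_mul, smul_eq_mul] at h1
  have h2 : 0 ≤ 2 / (x ⬝ᵥ x) * (x ⬝ᵥ B *ᵥ x) := by linarith
  exact (mul_nonneg_iff_of_pos_left (by positivity)).1 h2

/-- The competitor is the product of two reflections, that is, a rotation in the plane of a and b.
For b close to a it is near the identity and detects the antisymmetric part of B. -/
theorem two_mul_le_of_trace_le {B : Matrix n n ℝ}
    (hB : ∀ R ∈ Matrix.orthogonalGroup n ℝ, (Rᵀ * B).trace ≤ B.trace) {a b : n → ℝ}
    (ha : a ≠ 0) (hb : b ≠ 0) :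
    2 * ((b ⬝ᵥ a) * (a ⬝ᵥ B *ᵥ b)) ≤
      (b ⬝ᵥ b) * (a ⬝ᵥ B *ᵥ a) + (a ⬝ᵥ a) * (b ⬝ᵥ B *ᵥ b) := by
  have ha0 : 0 < a ⬝ᵥ a := dotProduct_self_pos ha
  have hb0 : 0 < b ⬝ᵥ b := dotProduct_self_pos hb
  have h1 := hB _ (mul_mem (householder_mem a ha) (householder_mem b hb))
  rw [Matrix.transpose_mul, householder_transpose, householder_transpose, householder,
    householder] at h1
  simp only [mul_sub, sub_mul, mul_one, one_mul, smul_mul_assoc, mul_smul_comm,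
    Matrix.vecMulVec_mul_vecMulVec, smul_smul, Matrix.vecMulVec_smul, Matrix.trace_sub,
    Matrix.trace_smul, trace_vecMulVec_mul, smul_eq_mul] at h1
  have h2 : 4 / ((a ⬝ᵥ a) * (b ⬝ᵥ b)) * ((b ⬝ᵥ a) * (a ⬝ᵥ B *ᵥ b)) ≤
      2 / (a ⬝ᵥ a) * (a ⬝ᵥ B *ᵥ a) + 2 / (b ⬝ᵥ b) * (b ⬝ᵥ B *ᵥ b) := by
    have : 2 / (a ⬝ᵥ a) * (2 / (b ⬝ᵥ b) * (b ⬝ᵥ a)) * (a ⬝ᵥ B *ᵥ b) =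
        4 / ((a ⬝ᵥ a) * (b ⬝ᵥ b)) * ((b ⬝ᵥ a) * (a ⬝ᵥ B *ᵥ b)) := by
      field_simp; ring
    linarith
  have h3 := mul_le_mul_of_nonneg_left h2 (mul_pos ha0 hb0).le
  field_simp at h3
  linarith

theorem isSymm_of_trace_le {B : Matrix n n ℝ}
    (hB : ∀ R ∈ Matrix.orthogonalGroup n ℝ, (Rᵀ * B).trace ≤ B.trace) : B.IsSymm := by
  have key : ∀ i j, i ≠ j → B i j ≤ B j i := by
    intro i j hij
    -- The rotation inequality for a = e_i and b = e_i + ε e_j: the terms of order zero cancel, and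
    -- division by ε leaves this bound.
    have h1 : ∀ ε : ℝ, 0 < ε → B i j - B j i ≤ (B i i + B j j) * ε := by
      intro ε hε
      have hb : (Pi.single i 1 + ε • Pi.single j 1 : n → ℝ) ≠ 0 := fun h => by
        have := congrFun h i
        simp [hij] at this
      have ha : (Pi.single i 1 : n → ℝ) ≠ 0 := by simp
      have h2 := two_mul_le_of_trace_le hB ha hb
      simp [Matrix.mulVec_add, Matrix.mulVec_smul, hij, hij.symm, add_dotProduct,
        dotProduct_add] at h2
      have h3 : ε * (B i j - B j i) ≤ ε * ((B i i + B j j) * ε) := by nlinarith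
      exact le_of_mul_le_mul_left h3 hε
    have h4 : Tendsto (fun ε : ℝ => (B i i + B j j) * ε) (𝓝[>] 0) (𝓝 0) := by
      have : Tendsto (fun ε : ℝ => (B i i + B j j) * ε) (𝓝 0) (𝓝 ((B i i + B j j) * 0)) :=
        (continuous_const.mul continuous_id).tendsto 0
      rw [mul_zero] at this
      exact this.mono_left nhdsWithin_le_nhds
    have h5 := ge_of_tendsto h4 (by filter_upwards [self_mem_nhdsWithin] with ε hε using h1 ε hε)
    linarith
  refine Matrix.IsSymm.ext fun i j => ?_
  by_cases hij : i = j
  · rw [hij]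
  · exact le_antisymm (key j i (Ne.symm hij)) (key i j hij)

theorem posSemidef_of_trace_le {B : Matrix n n ℝ}
    (hB : ∀ R ∈ Matrix.orthogonalGroup n ℝ, (Rᵀ * B).trace ≤ B.trace) : B.PosSemidef :=
  .of_dotProduct_mulVec_nonneg (by
    rw [Matrix.IsHermitian, Matrix.conjTranspose_eq_transpose_of_trivial]
    exact isSymm_of_trace_le hB) (dotProduct_mulVec_nonneg_of_trace_le hB)

theorem exists_transpose_mul_self_of_posSemidef {B : Matrix n n ℝ} (hB : B.PosSemidef) :
    ∃ Y : Matrix n n ℝ, B = Yᵀ * Y := by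
  open scoped MatrixOrder in
  obtain ⟨Y, hY⟩ := CStarAlgebra.nonneg_iff_eq_star_mul_self.1 (Matrix.nonneg_iff_posSemidef.2 hB)
  exact ⟨Y, hY⟩

/-- With B = YᵀY the trace is the sum of the quadratic form of D over the rows of Y, so D need not
be symmetric. -/
theorem trace_mul_le_of_posSemidef {B D : Matrix n n ℝ} (hB : B.PosSemidef)
    (hD : ∀ x : n → ℝ, x ⬝ᵥ D *ᵥ x ≤ x ⬝ᵥ x) : (D * B).trace ≤ B.trace := by
  obtain ⟨Y, rfl⟩ := exists_transpose_mul_self_of_posSemidef hB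
  rw [← mul_assoc, Matrix.trace_mul_comm, Matrix.trace_mul_comm Yᵀ]
  refine Finset.sum_le_sum fun i _ => ?_
  have := hD (Y i)
  simpa [Matrix.diag, Matrix.mul_apply, dotProduct, Matrix.mulVec, Finset.mul_sum] using this

/-- For B = YᵀY the squared Frobenius norm of Y(1 - R)ᵀ is 2(tr B - tr RᵀB) = 0, so R fixes the
columns of Yᵀ. -/
theorem transpose_mul_eq_of_trace_eq {B R : Matrix n n ℝ} (hB : B.PosSemidef)
    (hR : R ∈ Matrix.orthogonalGroup n ℝ) (h : (Rᵀ * B).trace = B.trace) : Rᵀ * B = B := by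
  obtain ⟨Y, rfl⟩ := exists_transpose_mul_self_of_posSemidef hB
  have hR1 : Rᵀ * R = 1 := (Matrix.mem_orthogonalGroup_iff' n ℝ).1 hR
  have h1 : (R * (Yᵀ * Y)).trace = (Yᵀ * Y).trace := by
    rw [← h, ← Matrix.trace_transpose (R * _)]
    simp only [Matrix.transpose_mul, Matrix.transpose_transpose]
    rw [Matrix.trace_mul_comm]
  have h2 : (((Y * (1 - R)ᵀ))ᴴ * (Y * (1 - R)ᵀ)).trace = 0 := by
    rw [Matrix.conjTranspose_eq_transpose_of_trivial, Matrix.transpose_mul,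
      Matrix.transpose_transpose, ← mul_assoc, Matrix.trace_mul_comm, mul_assoc, ← mul_assoc,
      Matrix.transpose_sub, Matrix.transpose_one, sub_mul, mul_sub, mul_sub, hR1]
    simp only [one_mul, mul_one, sub_mul, Matrix.trace_sub, h, h1]
    ring
  have h3 : Y * (1 - R)ᵀ = 0 := Matrix.trace_conjTranspose_mul_self_eq_zero_iff.1 h2
  have h4 : (1 - R) * Yᵀ = 0 := by
    have := congrArg Matrix.transpose h3
    simpa using this
  have h5 : Yᵀ = R * Yᵀ := by rwa [sub_mul, one_mul, sub_eq_zero] at h4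
  conv_lhs => rw [h5]
  rw [← mul_assoc, ← mul_assoc, hR1, one_mul]

namespace IsPolarFactor

variable {A O O' : Matrix n n ℝ}

theorem trace_le (h : IsPolarFactor A O) {R : Matrix n n ℝ}
    (hR : R ∈ Matrix.orthogonalGroup n ℝ) : (Rᵀ * (Oᵀ * A)).trace ≤ (Oᵀ * A).trace := by
  have := h.2 (O * R) (mul_mem h.1 hR)
  rwa [Matrix.transpose_mul, mul_assoc] at this

theorem posSemidef (h : IsPolarFactor A O) : (Oᵀ * A).PosSemidef :=
  posSemidef_of_trace_le fun _ hR => h.trace_le hR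

theorem isSymm (h : IsPolarFactor A O) : (Oᵀ * A).IsSymm :=
  isSymm_of_trace_le fun _ hR => h.trace_le hR

theorem mul_transpose_self (h : IsPolarFactor A O) : O * Oᵀ = 1 :=
  (Matrix.mem_orthogonalGroup_iff n ℝ).1 h.1

/-- The positive part of a polar decomposition is unique, even when A is singular and its orthogonal
factor is not. -/
theorem transpose_mul_eq (h : IsPolarFactor A O) (h' : IsPolarFactor A O') :
    O'ᵀ * A = Oᵀ * A := by
  have hR : Oᵀ * O' ∈ Matrix.orthogonalGroup n ℝ :=
    mul_mem (Unitary.star_mem h.1) h'.1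
  have e : (Oᵀ * O')ᵀ * (Oᵀ * A) = O'ᵀ * A := by
    rw [Matrix.transpose_mul, Matrix.transpose_transpose, mul_assoc, ← mul_assoc O,
      h.mul_transpose_self, one_mul]
  have := transpose_mul_eq_of_trace_eq h.posSemidef hR (by
    rw [e]; exact le_antisymm (h.2 _ h'.1) (h'.2 _ h.1))
  rwa [e] at this

/-- Enlarging the competitors from orthogonal matrices to contractions does not raise the maximum.
This is what compares arbitrary bicausal couplings with orthogonal ones. -/
theorem trace_mul_le (h : IsPolarFactor A O) {C : Matrix n n ℝ}
    (hC : ∀ x : n → ℝ, x ⬝ᵥ (C * O) *ᵥ x ≤ x ⬝ᵥ x) : (C * A).trace ≤ (Oᵀ * A).trace := by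
  have := trace_mul_le_of_posSemidef h.posSemidef hC
  rwa [mul_assoc, ← mul_assoc O, h.mul_transpose_self, one_mul] at this

/-- The polar factors can be composed with the reflection in a vector of the kernel of `Aᵀ`. -/
theorem householder_mul (h : IsPolarFactor A O) {x : n → ℝ} (hx : x ≠ 0) (hA : Aᵀ *ᵥ x = 0) :
    IsPolarFactor A (householder x * O) := by
  refine ⟨mul_mem (householder_mem x hx) h.1, fun R hR => (h.2 R hR).trans_eq ?_⟩
  have : householder x * A = A := by
    rw [householder, sub_mul, one_mul, smul_mul_assoc, Matrix.vecMulVec_mul,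
      ← Matrix.mulVec_transpose, hA]
    simp
  rw [Matrix.transpose_mul, householder_transpose, mul_assoc, this]

end IsPolarFactor

/-- PᵀP has the rank of P, and ker P ⊆ ker QᵀP always holds; by rank-nullity the ranks agree exactly
when these kernels do. -/
theorem rank_transpose_mul_eq_iff {m n : Type*} [Fintype m] [Fintype n] (P Q : Matrix m n ℝ) :
    (Pᵀ * P).rank = (Pᵀ * Q).rank ↔ ∀ x, (Qᵀ * P) *ᵥ x = 0 → P *ᵥ x = 0 := by
  have e1 : (Pᵀ * Q).rank = (Qᵀ * P).rank := by
    rw [← Matrix.rank_transpose, Matrix.transpose_mul, Matrix.transpose_transpose]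
  rw [Matrix.rank_transpose_mul_self, e1, Matrix.rank, Matrix.rank]
  have r1 := P.mulVecLin.finrank_range_add_finrank_ker
  have r2 := (Qᵀ * P).mulVecLin.finrank_range_add_finrank_ker
  have hle : LinearMap.ker P.mulVecLin ≤ LinearMap.ker (Qᵀ * P).mulVecLin := by
    intro x hx
    simp only [LinearMap.mem_ker, Matrix.mulVecLin_apply] at hx ⊢
    rw [← Matrix.mulVec_mulVec, hx, Matrix.mulVec_zero]
  constructor
  · intro h x hx
    have := Submodule.eq_of_le_of_finrank_eq hle (by omega)
    have hx' : x ∈ LinearMap.ker (Qᵀ * P).mulVecLin := hx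
    rw [← this] at hx'
    simpa using hx'
  · intro h
    have : LinearMap.ker P.mulVecLin = LinearMap.ker (Qᵀ * P).mulVecLin :=
      le_antisymm hle fun x hx => by
        simp only [LinearMap.mem_ker, Matrix.mulVecLin_apply] at hx ⊢
        exact h x hx
    rw [this] at r1
    omega

end Polar

/-! ### The adapted Wasserstein distance of Gaussian processes -/

section Frobenius

variable {T d : ℕ}

theorem frobNorm_eq_sqrt_trace {m n : Type*} [Fintype m] [Fintype n] (A : Matrix m n ℝ) :
    frobNorm A = Real.sqrt (Aᵀ * A).trace := by
  rw [frobNorm, Finset.sum_comm]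
  simp [Matrix.trace, Matrix.mul_apply, sq]

theorem trace_transpose_mul_self_nonneg {m n : Type*} [Fintype m] [Fintype n] (A : Matrix m n ℝ) :
    0 ≤ (Aᵀ * A).trace :=
  (Matrix.posSemidef_conjTranspose_mul_self A).trace_nonneg

/-- The Frobenius inner product of block lower triangular matrices. -/
instance frobeniusCore (T d : ℕ) : InnerProductSpace.Core ℝ (BlockLower T d) where
  inner A B := ((mat A)ᵀ * mat B).trace
  conj_inner_symm A B := by
    rw [← Matrix.trace_transpose]
    simp
  re_inner_nonneg A := trace_transpose_mul_self_nonneg _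
  add_left A B C := by simp [add_mul]
  smul_left A B r := by simp
  definite A h := Subtype.ext (Matrix.trace_conjTranspose_mul_self_eq_zero_iff.1 h)

instance (T d : ℕ) : NormedAddCommGroup (BlockLower T d) :=
  (frobeniusCore T d).toNormedAddCommGroup

instance (T d : ℕ) : InnerProductSpace ℝ (BlockLower T d) := .ofCore (frobeniusCore T d).toCore

theorem inner_eq_trace (A B : BlockLower T d) : inner ℝ A B = ((mat A)ᵀ * mat B).trace := rfl

theorem norm_eq_frobNorm (A : BlockLower T d) : ‖A‖ = frobNorm (mat A) := by
  rw [norm_eq_sqrt_real_inner, inner_eq_trace, frobNorm_eq_sqrt_trace]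

theorem norm_sq_eq_trace (A : BlockLower T d) : ‖A‖ ^ 2 = ((mat A)ᵀ * mat A).trace := by
  rw [← real_inner_self_eq_norm_sq, inner_eq_trace]

theorem OGroup.transpose_mul_self (O : OGroup T d) : O.toMatrixᵀ * O.toMatrix = 1 := by
  rw [OGroup.toMatrix, Matrix.blockDiagonal_transpose, ← Matrix.blockDiagonal_mul]
  rw [← Matrix.blockDiagonal_one]
  congr 1
  funext t
  exact (Matrix.mem_orthogonalGroup_iff' _ _).1 (O t).2

theorem OGroup.mem_orthogonalGroup (O : OGroup T d) :
    O.toMatrix ∈ Matrix.orthogonalGroup (Fin d × Fin T) ℝ :=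
  (Matrix.mem_orthogonalGroup_iff' _ _).2 O.transpose_mul_self

theorem OGroup.mul_transpose_self (O : OGroup T d) : O.toMatrix * O.toMatrixᵀ = 1 :=
  (Matrix.mem_orthogonalGroup_iff _ _).1 O.mem_orthogonalGroup

theorem trace_blockDiagonal_mul (Q : Fin T → Matrix (Fin d) (Fin d) ℝ)
    (N : Matrix (Fin d × Fin T) (Fin d × Fin T) ℝ) :
    (Matrix.blockDiagonal Q * N).trace = ∑ t, (Q t * N.blockDiag t).trace := by
  simp only [Matrix.trace, Matrix.diag, Matrix.mul_apply, Matrix.blockDiagonal_apply,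
    Matrix.blockDiag_apply, Fintype.sum_prod_type]
  rw [Finset.sum_comm]
  simp [ite_mul]

theorem inner_mulO_left (M L : BlockLower T d) (O : OGroup T d) :
    inner ℝ (mulO M O) L = ∑ t, ((O t : Matrix (Fin d) (Fin d) ℝ)ᵀ * gramBlock M L t).trace := by
  rw [inner_eq_trace]
  change ((mat M * O.toMatrix)ᵀ * mat L).trace = _
  rw [Matrix.transpose_mul, mul_assoc, OGroup.toMatrix, Matrix.blockDiagonal_transpose,
    trace_blockDiagonal_mul]
  rfl

theorem norm_mulO (M : BlockLower T d) (O : OGroup T d) : ‖mulO M O‖ = ‖M‖ := by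
  rw [← sq_eq_sq₀ (norm_nonneg _) (norm_nonneg _), norm_sq_eq_trace, norm_sq_eq_trace]
  change ((mat M * O.toMatrix)ᵀ * (mat M * O.toMatrix)).trace = _
  rw [Matrix.trace_mul_comm, Matrix.transpose_mul, mul_assoc, ← mul_assoc O.toMatrix,
    O.mul_transpose_self, one_mul, Matrix.trace_mul_comm]

theorem mulO_sub (M N : BlockLower T d) (O : OGroup T d) :
    mulO (M - N) O = mulO M O - mulO N O :=
  Subtype.ext (sub_mul (mat M) (mat N) O.toMatrix)

theorem norm_sub_mulO_sq (L M : BlockLower T d) (O : OGroup T d) :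
    ‖L - mulO M O‖ ^ 2 = ‖L‖ ^ 2 + ‖M‖ ^ 2 -
      2 * ∑ t, ((O t : Matrix (Fin d) (Fin d) ℝ)ᵀ * gramBlock M L t).trace := by
  rw [norm_sub_sq_real, norm_mulO, real_inner_comm, inner_mulO_left]
  ring

/-- In ‖L - MO‖² only the linear term depends on O, and it splits over the diagonal blocks; varying
one block of O at a time separates the maximizations. -/
theorem mem_optO_iff {L M : BlockLower T d} {P : OGroup T d} :
    P ∈ optO L M ↔ ∀ t, IsPolarFactor (gramBlock M L t) (P t) := by
  have h0 : P ∈ optO L M ↔ ∀ O : OGroup T d,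
      ∑ t, ((O t : Matrix (Fin d) (Fin d) ℝ)ᵀ * gramBlock M L t).trace ≤
        ∑ t, ((P t : Matrix (Fin d) (Fin d) ℝ)ᵀ * gramBlock M L t).trace := by
    refine forall_congr' fun O => ?_
    rw [← norm_eq_frobNorm, ← norm_eq_frobNorm, ← sq_le_sq₀ (norm_nonneg _) (norm_nonneg _),
      norm_sub_mulO_sq, norm_sub_mulO_sq]
    constructor <;> intro h <;> linarith
  rw [h0]
  constructor
  · intro h t
    refine ⟨(P t).2, fun R hR => ?_⟩
    have h1 := h (Function.update P t ⟨R, hR⟩)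
    rw [← Finset.add_sum_erase _ _ (Finset.mem_univ t),
      ← Finset.add_sum_erase (a := t) Finset.univ
        (fun t => ((P t : Matrix (Fin d) (Fin d) ℝ)ᵀ * gramBlock M L t).trace)
        (Finset.mem_univ t), Function.update_self,
      Finset.sum_congr rfl fun s hs => by
        rw [Function.update_of_ne (Finset.ne_of_mem_erase hs)]] at h1
    exact le_of_add_le_add_right h1
  · intro h O
    exact Finset.sum_le_sum fun t _ => (h t).2 _ (O t).2

theorem optO_nonempty (L M : BlockLower T d) : (optO L M).Nonempty := by
  choose P hP using fun t => exists_isPolarFactor (gramBlock M L t)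
  exact ⟨fun t => ⟨P t, (hP t).1⟩, mem_optO_iff.2 hP⟩

end Frobenius

/-! ### Transport cost through second moments -/

section Cost

variable {T d : ℕ} {Ω : Type*} [mΩ : MeasurableSpace Ω] {μ : Measure Ω} {X Y : Ω → Path T d}

/-- The matrix of the second mixed moments of `X` and `Y`. -/
def crossMoment (μ : Measure Ω) (X Y : Ω → Path T d) :
    Matrix (Fin d × Fin T) (Fin d × Fin T) ℝ := fun a b => ∫ z, X z a * Y z b ∂μ

theorem crossMoment_self (hX : Measurable X) (hXμ : μ.map X = gaussianLaw T d) :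
    crossMoment μ X X = 1 := by
  ext a b
  rw [crossMoment, integral_coord_mul hX hXμ, Matrix.one_apply]

theorem integral_sum_mulVec_mul {m : Type*} [Fintype m]
    (hXY : ∀ a b, Integrable (fun z => X z a * Y z b) μ) (A B : Matrix m (Fin d × Fin T) ℝ) :
    Integrable (fun z => ∑ k, (A *ᵥ X z) k * (B *ᵥ Y z) k) μ ∧
      ∫ z, ∑ k, (A *ᵥ X z) k * (B *ᵥ Y z) k ∂μ = (crossMoment μ X Y * (Bᵀ * A)).trace := by
  have e : ∀ z, ∑ k, (A *ᵥ X z) k * (B *ᵥ Y z) k =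
      ∑ a, ∑ b, (X z a * Y z b) * (Bᵀ * A) b a := by
    intro z
    have : ∑ k, (A *ᵥ X z) k * (B *ᵥ Y z) k = X z ⬝ᵥ (Aᵀ * B) *ᵥ Y z := by
      rw [← Matrix.mulVec_mulVec, Matrix.dotProduct_mulVec, Matrix.vecMul_transpose]
      rfl
    rw [this, dotProduct]
    refine Finset.sum_congr rfl fun a _ => ?_
    rw [Matrix.mulVec, dotProduct, Finset.mul_sum]
    refine Finset.sum_congr rfl fun b _ => ?_
    rw [show (Aᵀ * B) a b = (Bᵀ * A) b a by
      rw [← Matrix.transpose_apply (Bᵀ * A), Matrix.transpose_mul, Matrix.transpose_transpose]]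
    ring
  simp only [e]
  have hi : ∀ a b, Integrable (fun z => (X z a * Y z b) * (Bᵀ * A) b a) μ :=
    fun a b => (hXY a b).mul_const _
  refine ⟨integrable_finsetSum _ fun a _ => integrable_finsetSum _ fun b _ => hi a b, ?_⟩
  rw [integral_finsetSum _ fun a _ => integrable_finsetSum _ fun b _ => hi a b]
  rw [Matrix.trace]
  refine Finset.sum_congr rfl fun a _ => ?_
  rw [integral_finsetSum _ fun b _ => hi a b, Matrix.diag, Matrix.mul_apply]
  refine Finset.sum_congr rfl fun b _ => ?_
  rw [integral_mul_const, crossMoment]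

theorem integral_sum_sq_sub {m : Type*} [Fintype m]
    (hX : Measurable X) (hXμ : μ.map X = gaussianLaw T d)
    (hY : Measurable Y) (hYμ : μ.map Y = gaussianLaw T d) (A B : Matrix m (Fin d × Fin T) ℝ) :
    ∫ z, ∑ k, ((A *ᵥ X z) k - (B *ᵥ Y z) k) ^ 2 ∂μ =
      (Aᵀ * A).trace + (Bᵀ * B).trace - 2 * (crossMoment μ X Y * (Bᵀ * A)).trace := by
  obtain ⟨i1, e1⟩ := integral_sum_mulVec_mul (integrable_coord_mul hX hXμ hX hXμ) A A
  obtain ⟨i2, e2⟩ := integral_sum_mulVec_mul (integrable_coord_mul hY hYμ hY hYμ) B B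
  obtain ⟨i3, e3⟩ := integral_sum_mulVec_mul (integrable_coord_mul hX hXμ hY hYμ) A B
  rw [crossMoment_self hX hXμ, one_mul] at e1
  rw [crossMoment_self hY hYμ, one_mul] at e2
  rw [← e1, ← e2, ← e3, ← integral_const_mul, ← integral_add i1 i2]
  refine Eq.trans ?_ (integral_sub (i1.add i2) (i3.const_mul 2))
  congr 1
  funext z
  rw [Finset.mul_sum, ← Finset.sum_add_distrib, ← Finset.sum_sub_distrib]
  refine Finset.sum_congr rfl fun k _ => ?_
  ring

/-- Nonnegativity of E(x·X - y·Y)², with x and y read as one-row matrices; it says that the cross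
moment is a contraction. -/
theorem two_mul_dotProduct_crossMoment_le
    (hX : Measurable X) (hXμ : μ.map X = gaussianLaw T d)
    (hY : Measurable Y) (hYμ : μ.map Y = gaussianLaw T d) (x y : Fin d × Fin T → ℝ) :
    2 * (x ⬝ᵥ crossMoment μ X Y *ᵥ y) ≤ x ⬝ᵥ x + y ⬝ᵥ y := by
  have h1 := integral_sum_sq_sub hX hXμ hY hYμ (Matrix.replicateRow Unit x)
    (Matrix.replicateRow Unit y)
  have h2 : 0 ≤ ∫ z, ∑ k, ((Matrix.replicateRow Unit x *ᵥ X z) k -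
      (Matrix.replicateRow Unit y *ᵥ Y z) k) ^ 2 ∂μ :=
    integral_nonneg fun z => Finset.sum_nonneg fun k _ => sq_nonneg _
  have e : ∀ u v : Fin d × Fin T → ℝ,
      (Matrix.replicateRow Unit u)ᵀ * Matrix.replicateRow Unit v = Matrix.vecMulVec u v := by
    intro u v
    ext a b
    simp [Matrix.mul_apply, Matrix.vecMulVec_apply]
  rw [h1, e, e, e, Matrix.trace_vecMulVec, Matrix.trace_vecMulVec, Matrix.trace_mul_comm,
    trace_vecMulVec_mul] at h2
  linarith

/-- A block diagonal cross moment meets only the diagonal blocks of MᵀL, and each of its blocks is a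
contraction, so the polar factors dominate block by block. -/
theorem trace_crossMoment_mul_le
    (hX : Measurable X) (hXμ : μ.map X = gaussianLaw T d)
    (hY : Measurable Y) (hYμ : μ.map Y = gaussianLaw T d)
    (h0 : ∀ a b, a.2 ≠ b.2 → crossMoment μ X Y a b = 0)
    {L M : BlockLower T d} {P : OGroup T d} (hP : P ∈ optO L M) :
    (crossMoment μ X Y * ((mat M)ᵀ * mat L)).trace ≤
      ∑ t, ((P t : Matrix (Fin d) (Fin d) ℝ)ᵀ * gramBlock M L t).trace := by
  set C := crossMoment μ X Y with hC
  have e : C = Matrix.blockDiagonal C.blockDiag := by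
    ext a b
    rw [Matrix.blockDiagonal_apply]
    split_ifs with hab
    · rw [Matrix.blockDiag_apply]
      congr 1
      exact Prod.ext rfl hab.symm
    · exact h0 a b hab
  rw [e, trace_blockDiagonal_mul]
  refine Finset.sum_le_sum fun t _ => (mem_optO_iff.1 hP t).trace_mul_le fun x => ?_
  rw [← Matrix.mulVec_mulVec]
  set y := (P t : Matrix (Fin d) (Fin d) ℝ) *ᵥ x with hy
  have hyx : y ⬝ᵥ y = x ⬝ᵥ x := by
    rw [hy, Matrix.dotProduct_mulVec, Matrix.vecMul_mulVec,
      (Matrix.mem_orthogonalGroup_iff' _ _).1 (P t).2, Matrix.vecMul_one]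
  -- Vectors supported at time t restrict the contraction bound to the block C_{t,t}.
  have h1 := two_mul_dotProduct_crossMoment_le hX hXμ hY hYμ
    (fun a => if a.2 = t then x a.1 else 0) (fun a => if a.2 = t then y a.1 else 0)
  rw [← hC] at h1
  simp only [dotProduct, Matrix.mulVec, Fintype.sum_prod_type, mul_ite, ite_mul, mul_zero,
    zero_mul, Finset.sum_ite_eq', Finset.mem_univ, if_true] at h1
  have h2 : 2 * (x ⬝ᵥ C.blockDiag t *ᵥ y) ≤ x ⬝ᵥ x + y ⬝ᵥ y := by
    simpa [dotProduct, Matrix.mulVec, Matrix.blockDiag_apply] using h1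
  linarith

end Cost

/-! ### Optimal couplings and the quotient distance -/

section Coupling

variable {T d : ℕ}

/-- Bicausal couplings cost at least as much as the best orthogonal coupling. -/
theorem norm_sub_mulO_sq_le_of_isBicausalCoupling {L M : BlockLower T d} {P : OGroup T d}
    (hP : P ∈ optO L M) {π : Measure (Path T d × Path T d)} [IsProbabilityMeasure π]
    (hπ : IsBicausalCoupling (gaussianFiltration T d) (gaussianLaw T d) (gaussianFiltration T d)
      (gaussianLaw T d) π) :
    ‖L - mulO M P‖ ^ 2 ≤ ∫ z, ∑ k, ((mat L *ᵥ z.1) k - (mat M *ᵥ z.2) k) ^ 2 ∂π := by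
  -- Anticausality kills the entries above the diagonal blocks, causality those below.
  have h0 : ∀ a b, a.2 ≠ b.2 → crossMoment π Prod.fst Prod.snd a b = 0 := by
    intro a b hab
    rcases lt_or_gt_of_ne hab with h | h
    · exact integral_coord_mul_eq_zero measurable_fst hπ.fst measurable_snd hπ.snd h
        (hπ.anticausal a.2)
    · have := integral_coord_mul_eq_zero measurable_snd hπ.snd measurable_fst hπ.fst h
        (hπ.causal b.2)
      simpa only [crossMoment, mul_comm] using this
  rw [integral_sum_sq_sub measurable_fst hπ.fst measurable_snd hπ.snd, norm_sub_mulO_sq,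
    norm_sq_eq_trace, norm_sq_eq_trace]
  have := trace_crossMoment_mul_le measurable_fst hπ.fst measurable_snd hπ.snd h0 hP
  linarith

theorem measurable_mulVec_filtration {A : Matrix (Fin d × Fin T) (Fin d × Fin T) ℝ}
    (hA : A ∈ BlockLower T d) (t : Fin T) :
    @Measurable _ _ (gaussianFiltration T d t) (gaussianFiltration T d t)
      (fun ω : Path T d => A *ᵥ ω) := by
  rw [measurable_iff_comap_le, comap_gaussianFiltration]
  refine iSup₂_le fun k hk => ?_
  rw [← measurable_iff_comap_le]
  change @Measurable _ _ (gaussianFiltration T d t) _ fun ω : Path T d => ∑ a, A k a * ω a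
  refine Finset.measurable_sum _ fun a _ => ?_
  by_cases ha : k.2 < a.2
  · simp only [hA k a ha, zero_mul]
    exact measurable_const
  · refine Measurable.const_mul ?_ _
    rw [measurable_iff_comap_le]
    have h1 := comap_coord_le (id : Path T d → Path T d) a
    rw [MeasurableSpace.comap_id] at h1
    exact h1.trans ((gaussianFiltration T d).mono ((not_lt.1 ha).trans hk))

/-- The coupling of `G` and `O G`. -/
def orthogonalCoupling (O : OGroup T d) : Measure (Path T d × Path T d) :=
  (gaussianLaw T d).map fun ω => (ω, O.toMatrix *ᵥ ω)

theorem measurable_mulVec (A : Matrix (Fin d × Fin T) (Fin d × Fin T) ℝ) :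
    Measurable fun ω : Path T d => A *ᵥ ω :=
  (Continuous.matrix_mulVec continuous_const continuous_id).measurable

theorem measurable_orthogonalCoupling (O : OGroup T d) :
    Measurable fun ω : Path T d => (ω, O.toMatrix *ᵥ ω) :=
  measurable_id.prodMk (measurable_mulVec _)

instance (O : OGroup T d) : IsProbabilityMeasure (orthogonalCoupling O) :=
  Measure.isProbabilityMeasure_map (measurable_orthogonalCoupling O).aemeasurable

theorem ae_orthogonalCoupling (O : OGroup T d) :
    ∀ᵐ z ∂orthogonalCoupling O, z.2 = O.toMatrix *ᵥ z.1 := by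
  rw [orthogonalCoupling, ae_map_iff (measurable_orthogonalCoupling O).aemeasurable]
  · exact ae_of_all _ fun ω => rfl
  · exact measurableSet_eq_fun measurable_snd ((measurable_mulVec _).comp measurable_fst)

theorem OGroup.toMatrix_mem (O : OGroup T d) : O.toMatrix ∈ BlockLower T d := by
  intro a b hab
  simp [OGroup.toMatrix, Matrix.blockDiagonal_apply, hab.ne]

theorem OGroup.transpose_toMatrix_mem (O : OGroup T d) : O.toMatrixᵀ ∈ BlockLower T d := by
  intro a b hab
  simp [OGroup.toMatrix, Matrix.blockDiagonal_apply, hab.ne']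

/-- O and Oᵀ are both block lower triangular, so each copy is an adapted function of the other and
the two filtrations agree almost surely at every time. -/
theorem isBicausalCoupling_orthogonalCoupling (O : OGroup T d) :
    IsBicausalCoupling (gaussianFiltration T d) (gaussianLaw T d) (gaussianFiltration T d)
      (gaussianLaw T d) (orthogonalCoupling O) where
  fst := by
    rw [orthogonalCoupling, Measure.map_map measurable_fst (measurable_orthogonalCoupling O)]
    exact Measure.map_id
  snd := by
    rw [orthogonalCoupling, Measure.map_map measurable_snd (measurable_orthogonalCoupling O)]
    exact map_mulVec_gaussianLaw _ O.mem_orthogonalGroup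
  causal t := by
    refine condIndep_of_ae_le _ ((MeasurableSpace.comap_mono
      (iSup_le fun s => (gaussianFiltration T d).le s)).trans measurable_fst.comap_le)
      ((MeasurableSpace.comap_mono ((gaussianFiltration T d).le t)).trans
        measurable_snd.comap_le) ?_
    rintro B ⟨B₀, hB₀, rfl⟩
    refine ⟨Prod.fst ⁻¹' ((fun ω => O.toMatrix *ᵥ ω) ⁻¹' B₀),
      ⟨_, measurable_mulVec_filtration O.toMatrix_mem t hB₀, rfl⟩, ?_⟩
    filter_upwards [ae_orthogonalCoupling O] with z hz
    change (z.2 ∈ B₀) = (O.toMatrix *ᵥ z.1 ∈ B₀)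
    rw [hz]
  anticausal t := by
    refine condIndep_of_ae_le _ ((MeasurableSpace.comap_mono
      (iSup_le fun s => (gaussianFiltration T d).le s)).trans measurable_snd.comap_le)
      ((MeasurableSpace.comap_mono ((gaussianFiltration T d).le t)).trans
        measurable_fst.comap_le) ?_
    rintro B ⟨B₀, hB₀, rfl⟩
    refine ⟨Prod.snd ⁻¹' ((fun ω => O.toMatrixᵀ *ᵥ ω) ⁻¹' B₀),
      ⟨_, measurable_mulVec_filtration O.transpose_toMatrix_mem t hB₀, rfl⟩, ?_⟩
    filter_upwards [ae_orthogonalCoupling O] with z hz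
    change (z.1 ∈ B₀) = (O.toMatrixᵀ *ᵥ z.2 ∈ B₀)
    rw [hz, Matrix.mulVec_mulVec, O.transpose_mul_self, Matrix.one_mulVec]

theorem integral_orthogonalCoupling (L M : BlockLower T d) (O : OGroup T d) :
    ∫ z, ∑ k, ((mat L *ᵥ z.1) k - (mat M *ᵥ z.2) k) ^ 2 ∂orthogonalCoupling O =
      ‖L - mulO M O‖ ^ 2 := by
  have hi : Measurable fun ω : Path T d => ω := measurable_id
  rw [orthogonalCoupling, integral_map (measurable_orthogonalCoupling O).aemeasurable,
    norm_sq_eq_trace]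
  -- Under this coupling the cost is the second moment of (L - MO)G, obtained by taking the second
  -- matrix to be zero.
  · have h1 := integral_sum_sq_sub hi Measure.map_id' hi Measure.map_id'
      (mat (L - mulO M O)) (0 : Matrix (Fin d × Fin T) (Fin d × Fin T) ℝ)
    simp only [Matrix.transpose_zero, zero_mul, mul_zero, Matrix.trace_zero, add_zero, sub_zero,
      Matrix.zero_mulVec, Pi.zero_apply] at h1
    rw [← h1]
    congr 1
    funext ω
    refine Finset.sum_congr rfl fun k _ => ?_
    change _ = (((mat L - mat M * O.toMatrix) *ᵥ ω) k) ^ 2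
    rw [Matrix.sub_mulVec, ← Matrix.mulVec_mulVec, Pi.sub_apply]
  · refine Measurable.aestronglyMeasurable (Finset.measurable_sum _ fun k _ => ?_)
    exact ((measurable_pi_apply k).comp ((measurable_mulVec _).comp measurable_fst) |>.sub
      ((measurable_pi_apply k).comp ((measurable_mulVec _).comp measurable_snd))).pow_const 2

theorem dABW_eq_norm {L M : BlockLower T d} {P : OGroup T d} (hP : P ∈ optO L M) :
    dABW L M = ‖L - mulO M P‖ := by
  have : IsLeast {c : ℝ | ∃ π : ProbabilityMeasure (Path T d × Path T d),
      IsBicausalCoupling (gaussianFiltration T d) (gaussianLaw T d) (gaussianFiltration T d)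
        (gaussianLaw T d) (π : Measure (Path T d × Path T d)) ∧
      c = ∫ z, ∑ k, ((mat L *ᵥ z.1) k - (mat M *ᵥ z.2) k) ^ 2
        ∂(π : Measure (Path T d × Path T d))} (‖L - mulO M P‖ ^ 2) := by
    constructor
    · exact ⟨⟨orthogonalCoupling P, inferInstance⟩, isBicausalCoupling_orthogonalCoupling P,
        (integral_orthogonalCoupling L M P).symm⟩
    · rintro c ⟨π, hπ, rfl⟩
      exact norm_sub_mulO_sq_le_of_isBicausalCoupling hP hπ
  rw [dABW, adaptedWasserstein, this.csInf_eq, Real.sqrt_sq (norm_nonneg _)]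

theorem dABW_le (L M : BlockLower T d) (O : OGroup T d) : dABW L M ≤ ‖L - mulO M O‖ := by
  obtain ⟨P, hP⟩ := optO_nonempty L M
  rw [dABW_eq_norm hP, norm_eq_frobNorm, norm_eq_frobNorm]
  exact hP O

theorem dABW_mulO_le (L M : BlockLower T d) (O O' : OGroup T d) :
    dABW (mulO L O) (mulO M O') ≤ dABW L M := by
  obtain ⟨P, hP⟩ := optO_nonempty L M
  rw [dABW_eq_norm hP, ← norm_mulO (L - mulO M P) O, mulO_sub]
  -- The competitor O'⁻¹PO turns the difference into (L - MP)O, whose norm is that of L - MP.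
  have := dABW_le (mulO L O) (mulO M O') (O'⁻¹ * (P * O))
  rwa [mulO_mulO, mul_inv_cancel_left, ← mulO_mulO] at this

theorem cls_eq_cls_iff {L M : BlockLower T d} : cls L = cls M ↔ ∃ O : OGroup T d, L = mulO M O :=
  Quotient.eq (r := orbitSetoid T d)

theorem distABW_cls (L M : BlockLower T d) : distABW (cls L) (cls M) = dABW L M := by
  have : {c : ℝ | ∃ L' M' : BlockLower T d, cls L' = cls L ∧ cls M' = cls M ∧ c = dABW L' M'} =
      {dABW L M} := by
    ext c
    constructor
    · rintro ⟨L', M', hL, hM, rfl⟩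
      obtain ⟨O, rfl⟩ := cls_eq_cls_iff.1 hL
      obtain ⟨O', rfl⟩ := cls_eq_cls_iff.1 hM
      refine le_antisymm (dABW_mulO_le L M O O') ?_
      have := dABW_mulO_le (mulO L O) (mulO M O') O⁻¹ O'⁻¹
      rwa [mulO_mulO, mulO_mulO, mul_inv_cancel, mul_inv_cancel, mulO_one, mulO_one] at this
    · rintro rfl
      exact ⟨L, M, rfl, rfl, rfl⟩
  rw [distABW, this, csInf_singleton]

theorem distABW_eq_norm {L M : BlockLower T d} {P : OGroup T d} (hP : P ∈ optO L M) :
    distABW (cls L) (cls M) = ‖L - mulO M P‖ := by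
  rw [distABW_cls, dABW_eq_norm hP]

theorem distABW_le (L M : BlockLower T d) (O : OGroup T d) :
    distABW (cls L) (cls M) ≤ ‖L - mulO M O‖ := by
  rw [distABW_cls]
  exact dABW_le L M O

theorem mem_optO_of_distABW_eq {L M : BlockLower T d} {P : OGroup T d}
    (h : distABW (cls L) (cls M) = ‖L - mulO M P‖) : P ∈ optO L M := by
  intro O
  rw [← norm_eq_frobNorm, ← norm_eq_frobNorm, ← h]
  exact distABW_le L M O

end Coupling

/-! ### The geometry of `𝐋 / 𝐎` at a regular point -/

section FrobeniusBounds

attribute [local instance] Matrix.frobeniusNormedAddCommGroup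

theorem frobNorm_eq_norm {m n : Type*} [Fintype m] [Fintype n] (A : Matrix m n ℝ) :
    frobNorm A = ‖A‖ := by
  rw [Matrix.frobenius_norm_def, ← Real.sqrt_eq_rpow, frobNorm]
  simp

theorem frobNorm_mul_le {l m n : Type*} [Fintype l] [Fintype m] [Fintype n]
    (A : Matrix l m ℝ) (B : Matrix m n ℝ) : frobNorm (A * B) ≤ frobNorm A * frobNorm B := by
  rw [frobNorm_eq_norm, frobNorm_eq_norm, frobNorm_eq_norm]
  exact Matrix.frobenius_norm_mul A B

theorem frobNorm_transpose {m n : Type*} [Fintype m] [Fintype n] (A : Matrix m n ℝ) :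
    frobNorm Aᵀ = frobNorm A := by
  rw [frobNorm_eq_norm, frobNorm_eq_norm, Matrix.frobenius_norm_transpose]

theorem frobNorm_nonneg {m n : Type*} [Fintype m] [Fintype n] (A : Matrix m n ℝ) :
    0 ≤ frobNorm A :=
  Real.sqrt_nonneg _

theorem abs_trace_transpose_mul_le {m n : Type*} [Fintype m] [Fintype n] (A B : Matrix m n ℝ) :
    |(Aᵀ * B).trace| ≤ frobNorm A * frobNorm B := by
  have e : (Aᵀ * B).trace = ∑ p : m × n, A p.1 p.2 * B p.1 p.2 := by
    rw [Fintype.sum_prod_type, Finset.sum_comm]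
    simp [Matrix.trace, Matrix.mul_apply]
  have e' : ∀ C : Matrix m n ℝ, frobNorm C = Real.sqrt (∑ p : m × n, C p.1 p.2 ^ 2) := by
    intro C
    rw [frobNorm, Fintype.sum_prod_type]
  rw [e, e', e', ← Real.sqrt_mul (Finset.sum_nonneg fun _ _ => sq_nonneg _)]
  exact Real.abs_le_sqrt (Finset.sum_mul_sq_le_sq_mul_sq _ _ _)

end FrobeniusBounds

section Horizontal

variable {T d : ℕ}

theorem gramBlock_add_left (A B L : BlockLower T d) (t : Fin T) :
    gramBlock (A + B) L t = gramBlock A L t + gramBlock B L t := by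
  ext i j
  simp [gramBlock, add_mul, Matrix.blockDiag_apply]

theorem gramBlock_smul_left (c : ℝ) (A L : BlockLower T d) (t : Fin T) :
    gramBlock (c • A) L t = c • gramBlock A L t := by
  ext i j
  simp [gramBlock, Matrix.blockDiag_apply]

theorem gramBlock_transpose (A B : BlockLower T d) (t : Fin T) :
    (gramBlock A B t)ᵀ = gramBlock B A t := by
  rw [gramBlock, ← Matrix.blockDiag_transpose, Matrix.transpose_mul, Matrix.transpose_transpose]
  rfl

theorem gramBlock_mulO_left (M L : BlockLower T d) (P : OGroup T d) (t : Fin T) :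
    gramBlock (mulO M P) L t = (P t : Matrix (Fin d) (Fin d) ℝ)ᵀ * gramBlock M L t := by
  ext i j
  change ((mat M * P.toMatrix)ᵀ * mat L) (i, t) (j, t) = _
  rw [Matrix.transpose_mul, mul_assoc, OGroup.toMatrix, Matrix.blockDiagonal_transpose,
    Matrix.mul_apply, Fintype.sum_prod_type]
  simp [Matrix.blockDiagonal_apply, Matrix.mul_apply (M := (P t : Matrix (Fin d) (Fin d) ℝ)ᵀ),
    gramBlock, Matrix.blockDiag_apply]

/-- The horizontal space `𝒱(L)`. -/
def horizontalSpace (L : BlockLower T d) : Submodule ℝ (BlockLower T d) where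
  carrier := tangentSpace L
  add_mem' := fun {A B} hA hB t => by
    rw [gramBlock_add_left]
    exact (hA t).add (hB t)
  zero_mem' := fun t => by
    have := gramBlock_smul_left 0 (0 : BlockLower T d) L t
    rw [zero_smul, zero_smul] at this
    rw [this]
    exact Matrix.isSymm_zero
  smul_mem' := fun c A hA t => by
    rw [gramBlock_smul_left]
    exact (hA t).smul c

theorem self_mem_horizontalSpace (L : BlockLower T d) : L ∈ horizontalSpace L :=
  fun t => gramBlock_transpose L L t

theorem add_smul_mem_horizontalSpace {L V : BlockLower T d} (hV : V ∈ horizontalSpace L) (u : ℝ) :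
    V ∈ horizontalSpace (L + u • V) := fun t => by
  have h1 : gramBlock V (L + u • V) t = gramBlock V L t + u • gramBlock V V t := by
    rw [← gramBlock_transpose, gramBlock_add_left, gramBlock_smul_left, Matrix.transpose_add,
      Matrix.transpose_smul, gramBlock_transpose, gramBlock_transpose]
  rw [h1]
  exact (hV t).add ((self_mem_horizontalSpace V t).smul u)

/-- The relevant block of (MP)ᵀL is P_tᵀ(MᵀL)_{t,t}, the symmetric part of a polar decomposition,
and L itself is horizontal at L. -/
theorem mulO_sub_mem_tangentSpace {L M : BlockLower T d} {P : OGroup T d} (hP : P ∈ optO L M) :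
    mulO M P - L ∈ tangentSpace L := by
  have h1 : mulO M P ∈ horizontalSpace L := fun t => by
    rw [gramBlock_mulO_left]
    exact (mem_optO_iff.1 hP t).isSymm
  exact (horizontalSpace L).sub_mem h1 (self_mem_horizontalSpace L)

theorem norm_sub_mulO_self_le (N : BlockLower T d) (O : OGroup T d) :
    ‖N - mulO N O‖ ≤ ‖N‖ * frobNorm (1 - O.toMatrix) := by
  rw [norm_eq_frobNorm, norm_eq_frobNorm]
  have : mat (N - mulO N O) = mat N * (1 - O.toMatrix) := by
    rw [mul_sub, mul_one]; rfl
  rw [this]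
  exact frobNorm_mul_le _ _

/-- For horizontal `D` the inner product with `N - N O` is of second order in `1 - O`. -/
theorem abs_two_mul_inner_sub_mulO_le {D N : BlockLower T d} (hD : D ∈ horizontalSpace N)
    (O : OGroup T d) :
    |2 * inner ℝ D (N - mulO N O)| ≤ ‖D‖ * ‖N‖ * frobNorm (1 - O.toMatrix) ^ 2 := by
  have e1 : inner ℝ D (N - mulO N O) = ((mat D)ᵀ * mat N).trace -
      ((mat D)ᵀ * mat N * O.toMatrix).trace := by
    rw [inner_sub_right, inner_eq_trace, inner_eq_trace, mul_assoc]
    rfl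
  have e2 : ((mat D)ᵀ * mat N * O.toMatrix).trace = ((mat D)ᵀ * mat N * O.toMatrixᵀ).trace := by
    rw [Matrix.trace_mul_comm, Matrix.trace_mul_comm _ O.toMatrixᵀ, OGroup.toMatrix,
      Matrix.blockDiagonal_transpose, trace_blockDiagonal_mul, trace_blockDiagonal_mul]
    refine Finset.sum_congr rfl fun t _ => ?_
    have h1 : (((mat D)ᵀ * mat N).blockDiag t)ᵀ = ((mat D)ᵀ * mat N).blockDiag t := hD t
    rw [← Matrix.trace_transpose, Matrix.transpose_mul, h1, Matrix.trace_mul_comm]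
  -- Symmetry of the diagonal blocks lets Oᵀ replace O under the trace, and 2 - O - Oᵀ = (1 - O)ᵀ(1
  -- - O).
  have e3 : 2 * inner ℝ D (N - mulO N O) =
      ((mat D)ᵀ * (mat N * ((1 - O.toMatrix)ᵀ * (1 - O.toMatrix)))).trace := by
    have : (1 - O.toMatrix)ᵀ * (1 - O.toMatrix) = 1 + 1 - O.toMatrix - O.toMatrixᵀ := by
      rw [Matrix.transpose_sub, Matrix.transpose_one, sub_mul, mul_sub, mul_sub,
        O.transpose_mul_self]
      simp only [one_mul, mul_one]
      abel
    rw [this, ← mul_assoc, mul_sub, mul_sub, mul_add, mul_one, Matrix.trace_sub, Matrix.trace_sub,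
      Matrix.trace_add, ← e2, e1]
    ring
  rw [e3]
  refine (abs_trace_transpose_mul_le _ _).trans ?_
  rw [norm_eq_frobNorm, norm_eq_frobNorm, mul_assoc]
  refine mul_le_mul_of_nonneg_left ?_ (frobNorm_nonneg _)
  refine (frobNorm_mul_le _ _).trans (mul_le_mul_of_nonneg_left ?_ (frobNorm_nonneg _))
  refine (frobNorm_mul_le _ _).trans_eq ?_
  rw [frobNorm_transpose, sq]

/-- The block diagonal matrices, as a subspace of `𝐋`. -/
def blockDiagonalSpace (T d : ℕ) : Submodule ℝ (BlockLower T d) where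
  carrier := {X | ∀ a b, a.2 ≠ b.2 → mat X a b = 0}
  add_mem' := fun {A B} hA hB a b h => by simp [hA a b h, hB a b h]
  zero_mem' := fun _ _ _ => rfl
  smul_mem' := fun c A hA a b h => by simp [hA a b h]

theorem eq_blockDiagonal_of_mem {X : BlockLower T d} (hX : X ∈ blockDiagonalSpace T d) :
    mat X = Matrix.blockDiagonal (mat X).blockDiag := by
  ext a b
  rw [Matrix.blockDiagonal_apply]
  split_ifs with hab
  · rw [Matrix.blockDiag_apply]
    congr 1
    exact Prod.ext rfl hab.symm
  · exact hX a b hab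

/-- Left multiplication by `L`, on block diagonal matrices. -/
def leftMul (L : BlockLower T d) : blockDiagonalSpace T d →ₗ[ℝ] BlockLower T d where
  toFun X := ⟨mat L * mat X.1, fun a b h => by
    rw [Matrix.mul_apply]
    refine Finset.sum_eq_zero fun c _ => ?_
    by_cases hc : c.2 = b.2
    · exact mul_eq_zero_of_left (L.2 a c (hc ▸ h)) _
    · exact mul_eq_zero_of_right _ (X.2 c b hc)⟩
  map_add' X Y := Subtype.ext (mul_add (mat L) (mat X.1) (mat Y.1))
  map_smul' c X := Subtype.ext (mul_smul_comm c (mat L) (mat X.1))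

theorem ker_leftMul {L : BlockLower T d} (hL : IsRegularBW L) : LinearMap.ker (leftMul L) = ⊥ := by
  refine LinearMap.ker_eq_bot'.2 fun X hX => ?_
  have h1 : mat L * mat X.1 = 0 := congrArg Subtype.val hX
  have h2 : (mat L)ᵀ * mat L * mat X.1 = 0 := by rw [mul_assoc, h1, mul_zero]
  have h3 : ∀ t, (mat X.1).blockDiag t = 0 := by
    intro t
    have h4 : gramBlock L L t * (mat X.1).blockDiag t = 0 := by
      ext i j
      have := congrFun (congrFun h2 (i, t)) (j, t)
      rw [eq_blockDiagonal_of_mem X.2, Matrix.mul_apply, Fintype.sum_prod_type] at this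
      simpa [Matrix.blockDiagonal_apply, gramBlock, Matrix.mul_apply (N := (mat X.1).blockDiag t),
        Matrix.blockDiag_apply] using this
    exact (hL t).isUnit.mul_left_cancel (h4.trans (mul_zero _).symm)
  refine Subtype.ext (Subtype.ext ?_)
  change mat X.1 = 0
  rw [eq_blockDiagonal_of_mem X.2, show (mat X.1).blockDiag = 0 from funext h3,
    Matrix.blockDiagonal_zero]

/-- By regularity X ↦ LX is injective on block diagonal matrices, hence bounded below in finite
dimension; it is applied to X = 1 - O. -/
theorem exists_mul_frobNorm_le {L : BlockLower T d} (hL : IsRegularBW L) :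
    ∃ c > 0, ∀ O : OGroup T d, c * frobNorm (1 - O.toMatrix) ≤ ‖L - mulO L O‖ := by
  obtain ⟨K, hK, hanti⟩ := LinearMap.exists_antilipschitzWith (leftMul L) (ker_leftMul hL)
  refine ⟨(K : ℝ)⁻¹, inv_pos.2 hK, fun O => ?_⟩
  let X : blockDiagonalSpace T d := ⟨⟨1 - O.toMatrix, fun a b h => by
    rw [Matrix.sub_apply, O.toMatrix_mem a b h,
      Matrix.one_apply_ne (fun e => h.ne (congrArg Prod.snd e)),
      sub_zero]⟩, fun a b h => by
    change (1 - O.toMatrix) a b = 0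
    rw [Matrix.sub_apply, Matrix.one_apply_ne (fun e => h (congrArg Prod.snd e)), OGroup.toMatrix,
      Matrix.blockDiagonal_apply_ne _ _ _ h, sub_zero]⟩
  have h1 := hanti.le_mul_dist X 0
  rw [dist_zero_right, map_zero, dist_zero_right] at h1
  have h2 : ‖X‖ = frobNorm (1 - O.toMatrix) := norm_eq_frobNorm X.1
  have h3 : leftMul L X = L - mulO L O := Subtype.ext (by
    change mat L * (1 - O.toMatrix) = mat L - mat L * O.toMatrix
    rw [mul_sub, mul_one])
  rw [h2, h3] at h1
  rwa [inv_mul_le_iff₀ (NNReal.coe_pos.2 hK)]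

theorem add_smul_sub_mulO (L W : BlockLower T d) (u : ℝ) (O : OGroup T d) :
    (L + u • W) - mulO (L + u • W) O = (L - mulO L O) + u • (W - mulO W O) := by
  have : mulO (L + u • W) O = mulO L O + u • mulO W O := Subtype.ext (by
    change (mat L + u • mat W) * O.toMatrix = mat L * O.toMatrix + u • (mat W * O.toMatrix)
    rw [add_mul, smul_mul_assoc])
  rw [this, smul_sub]
  abel

theorem tendsto_mul_const_nhdsGT_zero (K : ℝ) : Tendsto (fun u : ℝ => u * K) (𝓝[>] 0) (𝓝 0) := by
  have : Tendsto (fun u : ℝ => u * K) (𝓝 0) (𝓝 (0 * K)) := tendsto_id.mul_const _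
  rw [zero_mul] at this
  exact this.mono_left nhdsWithin_le_nhds

/-- Lower bound for the displacement of the points close to a regular point. -/
theorem eventually_le_norm_sub_mulO {L : BlockLower T d} (hL : IsRegularBW L) :
    ∃ c > 0, ∀ W : BlockLower T d, ∀ᶠ u : ℝ in 𝓝[>] 0, ∀ O : OGroup T d,
      c * frobNorm (1 - O.toMatrix) ≤ ‖(L + u • W) - mulO (L + u • W) O‖ := by
  obtain ⟨c, hc, h⟩ := exists_mul_frobNorm_le hL
  -- The perturbation u(W - WO) is at most u‖W‖‖1 - O‖, which half of c absorbs for small u.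
  refine ⟨c / 2, half_pos hc, fun W => ?_⟩
  filter_upwards [(tendsto_mul_const_nhdsGT_zero ‖W‖).eventually (gt_mem_nhds (half_pos hc)),
    self_mem_nhdsWithin] with u hu hu0 O
  have hu0 : 0 < u := hu0
  rw [add_smul_sub_mulO]
  have h1 := h O
  have h2 := norm_sub_mulO_self_le W O
  have h3 := norm_sub_norm_le (L - mulO L O) (-(u • (W - mulO W O)))
  rw [sub_neg_eq_add, norm_neg, norm_smul, Real.norm_eq_abs, abs_of_pos hu0] at h3
  have h4 := mul_le_mul_of_nonneg_left h2 hu0.le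
  have h5 := mul_le_mul_of_nonneg_right hu.le (frobNorm_nonneg (1 - O.toMatrix))
  linarith

theorem norm_sub_mulO_sq_eq (L V W : BlockLower T d) (u : ℝ) (O : OGroup T d) :
    ‖(L + u • V) - mulO (L + u • W) O‖ ^ 2 = u ^ 2 * ‖V - W‖ ^ 2 +
      2 * (u * inner ℝ (V - W) ((L + u • W) - mulO (L + u • W) O)) +
      ‖(L + u • W) - mulO (L + u • W) O‖ ^ 2 := by
  have : (L + u • V) - mulO (L + u • W) O =
      u • (V - W) + ((L + u • W) - mulO (L + u • W) O) := by
    rw [smul_sub]; abel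
  rw [this, norm_add_sq_real, norm_smul, mul_pow, inner_smul_left, Real.norm_eq_abs, sq_abs]
  simp

theorem distABW_le_norm_sub (L M : BlockLower T d) : distABW (cls L) (cls M) ≤ ‖L - M‖ := by
  have := distABW_le L M 1
  rwa [mulO_one] at this

theorem eventually_distABW_radial {L V : BlockLower T d} (hL : IsRegularBW L)
    (hV : V ∈ horizontalSpace L) :
    ∀ᶠ u : ℝ in 𝓝[>] 0, distABW (cls L) (cls (L + u • V)) = u * ‖V‖ := by
  obtain ⟨c, hc, h⟩ := eventually_le_norm_sub_mulO hL
  have hc2 : 0 < c ^ 2 := by positivity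
  filter_upwards [h V, (tendsto_mul_const_nhdsGT_zero (‖V‖ * (‖L‖ + ‖V‖))).eventually
    (gt_mem_nhds hc2), (tendsto_mul_const_nhdsGT_zero 1).eventually (gt_mem_nhds one_pos),
    self_mem_nhdsWithin] with u h1 h2 hu1 hu0
  have hu0 : 0 < u := hu0
  obtain ⟨P, hP⟩ := optO_nonempty L (L + u • V)
  refine le_antisymm ?_ ?_
  · refine (distABW_le_norm_sub _ _).trans_eq ?_
    rw [sub_add_cancel_left, norm_neg, norm_smul, Real.norm_eq_abs, abs_of_pos hu0]
  · rw [distABW_eq_norm hP, ← sq_le_sq₀ (by positivity) (norm_nonneg _)]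
    have e := norm_sub_mulO_sq_eq L 0 V u P
    rw [smul_zero, add_zero, zero_sub, norm_neg, inner_neg_left] at e
    rw [e]
    -- V stays horizontal at L + uV, so there is no term linear in 1 - P, and for small u the
    -- quadratic one is dominated by c²‖1 - P‖².
    have h3 := abs_two_mul_inner_sub_mulO_le (add_smul_mem_horizontalSpace hV u) P
    have h4 := (abs_le.1 h3).2
    have h5 : ‖L + u • V‖ ≤ ‖L‖ + ‖V‖ := by
      refine (norm_add_le _ _).trans (add_le_add_right ?_ _)
      rw [norm_smul, Real.norm_eq_abs, abs_of_pos hu0]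
      exact mul_le_of_le_one_left (norm_nonneg _) (by linarith)
    set x := frobNorm (1 - P.toMatrix)
    have h6 : ‖V‖ * ‖L + u • V‖ * x ^ 2 ≤ ‖V‖ * (‖L‖ + ‖V‖) * x ^ 2 := by gcongr
    have h7 := mul_le_mul_of_nonneg_left (h4.trans h6) hu0.le
    have h8 : (c * x) ^ 2 ≤ ‖(L + u • V) - mulO (L + u • V) P‖ ^ 2 :=
      pow_le_pow_left₀ (mul_nonneg hc.le (frobNorm_nonneg _)) (h1 P) 2
    have h9 := mul_le_mul_of_nonneg_right h2.le (sq_nonneg x)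
    nlinarith

theorem eventually_distABW_conical {L V W : BlockLower T d} (hL : IsRegularBW L)
    (hV : V ∈ horizontalSpace L) (hW : W ∈ horizontalSpace L) :
    ∃ C : ℝ, ∀ᶠ u : ℝ in 𝓝[>] 0, u ^ 2 * ‖V - W‖ ^ 2 - C * u ^ 4 ≤
      distABW (cls (L + u • V)) (cls (L + u • W)) ^ 2 := by
  obtain ⟨c, hc, h⟩ := eventually_le_norm_sub_mulO hL
  have hc2 : 0 < c ^ 2 / 2 := by positivity
  set K := ‖V - W‖ * ‖W‖ with hK
  refine ⟨2 * K ^ 2 / c ^ 2, ?_⟩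
  filter_upwards [h W, (tendsto_mul_const_nhdsGT_zero (‖V - W‖ * ‖L‖)).eventually
    (gt_mem_nhds hc2), self_mem_nhdsWithin] with u h1 h2 hu0
  have hu0 : 0 < u := hu0
  obtain ⟨P, hP⟩ := optO_nonempty (L + u • V) (L + u • W)
  rw [distABW_eq_norm hP, norm_sub_mulO_sq_eq]
  set x := frobNorm (1 - P.toMatrix) with hx
  have hx0 : 0 ≤ x := frobNorm_nonneg _
  have h3 := (abs_le.1 (abs_two_mul_inner_sub_mulO_le ((horizontalSpace L).sub_mem hV hW) P)).1
  have h4 : -(K * x) ≤ inner ℝ (V - W) (W - mulO W P) := by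
    have a1 := (abs_le.1 (abs_real_inner_le_norm (V - W) (W - mulO W P))).1
    have a2 := mul_le_mul_of_nonneg_left (norm_sub_mulO_self_le W P) (norm_nonneg (V - W))
    rw [← mul_assoc] at a2
    linarith
  have h5 : inner ℝ (V - W) ((L + u • W) - mulO (L + u • W) P) =
      inner ℝ (V - W) (L - mulO L P) + u * inner ℝ (V - W) (W - mulO W P) := by
    rw [add_smul_sub_mulO, inner_add_right, inner_smul_right]
  have h8 : (c * x) ^ 2 ≤ ‖(L + u • W) - mulO (L + u • W) P‖ ^ 2 :=
    pow_le_pow_left₀ (mul_nonneg hc.le hx0) (h1 P) 2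
  have h9 := mul_le_mul_of_nonneg_right h2.le (sq_nonneg x)
  have h10 := mul_le_mul_of_nonneg_left h3 hu0.le
  have h11 := mul_le_mul_of_nonneg_left h4 (sq_nonneg u)
  -- V - W is horizontal at L but perhaps not at L + uW, which leaves a linear error 2u²Kx. Half of
  -- c²x² absorbs the quadratic error; completing the square with the other half leaves 2K²u⁴/c².
  have h12 : 0 ≤ (c * x - 2 * u ^ 2 * K / c) ^ 2 := sq_nonneg _
  have h13 : (c * x - 2 * u ^ 2 * K / c) ^ 2 =
      (c * x) ^ 2 - 4 * u ^ 2 * K * x + 2 * (2 * K ^ 2 / c ^ 2 * u ^ 4) := by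
    field_simp; ring
  rw [h5]
  nlinarith

/-- The lower bound on ‖L - LO‖ makes the stabilizer of a regular L trivial. -/
theorem mulO_eq_of_mulO_eq_self {L : BlockLower T d} (hL : IsRegularBW L) {O : OGroup T d}
    (h : mulO L O = L) (N : BlockLower T d) : mulO N O = N := by
  obtain ⟨c, hc, hcL⟩ := exists_mul_frobNorm_le hL
  have h1 := hcL O
  rw [h, sub_self, norm_zero] at h1
  have h2 : frobNorm (1 - O.toMatrix) = 0 :=
    le_antisymm (nonpos_of_mul_nonpos_right h1 hc) (frobNorm_nonneg _)
  have h3 := norm_sub_mulO_self_le N O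
  rw [h2, mul_zero] at h3
  exact (sub_eq_zero.1 (norm_le_zero_iff.1 h3)).symm

theorem distABW_triangle (L M N : BlockLower T d) :
    distABW (cls L) (cls N) ≤ distABW (cls L) (cls M) + distABW (cls M) (cls N) := by
  obtain ⟨P, hP⟩ := optO_nonempty L M
  obtain ⟨Q, hQ⟩ := optO_nonempty (mulO M P) N
  rw [distABW_eq_norm hP, ← show cls (mulO M P) = cls M from cls_eq_cls_iff.2 ⟨P, rfl⟩,
    distABW_eq_norm hQ]
  exact (distABW_le L N Q).trans (norm_sub_le_norm_sub_add_norm_sub _ _ _)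

theorem distABW_half {L V : BlockLower T d} (hV : distABW (cls L) (cls (L + V)) = ‖V‖) :
    distABW (cls L) (cls (L + (1 / 2 : ℝ) • V)) = ‖V‖ / 2 := by
  have h1 := distABW_le_norm_sub L (L + (1 / 2 : ℝ) • V)
  have h2 := distABW_le_norm_sub (L + (1 / 2 : ℝ) • V) (L + V)
  have h3 := distABW_triangle L (L + (1 / 2 : ℝ) • V) (L + V)
  have e1 : L - (L + (1 / 2 : ℝ) • V) = -((1 / 2 : ℝ) • V) := by module
  have e2 : L + (1 / 2 : ℝ) • V - (L + V) = -((1 / 2 : ℝ) • V) := by module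
  have e3 : ‖(1 / 2 : ℝ) • V‖ = ‖V‖ / 2 := by
    rw [norm_smul, Real.norm_eq_abs, abs_of_pos one_half_pos]; ring
  rw [e1, norm_neg, e3] at h1
  rw [e2, norm_neg, e3] at h2
  linarith

/-- At a regular point the quotient `𝐋 / 𝐎` is modelled on the horizontal space. -/
theorem isTangentModel {L : BlockLower T d} (hL : IsRegularBW L) :
    IsTangentModel distABW cls L (horizontalSpace L) where
  dist_le := distABW_le_norm_sub
  exists_lift x ξ := by
    obtain ⟨M, rfl⟩ : ∃ M, cls M = ξ := Quotient.exists_rep ξ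
    obtain ⟨P, hP⟩ := optO_nonempty x M
    exact ⟨mulO M P, cls_eq_cls_iff.2 ⟨P, rfl⟩, (distABW_eq_norm hP).symm⟩
  horizontal V hV := by
    have h1 : (1 : OGroup T d) ∈ optO L (L + V) := mem_optO_of_distABW_eq (by
      rw [hV, mulO_one, sub_add_cancel_left, norm_neg])
    have h2 := mulO_sub_mem_tangentSpace h1
    rwa [mulO_one, add_sub_cancel_left] at h2
  radial V hV := eventually_distABW_radial hL hV
  conical V hV W hW := by
    obtain ⟨C, hC⟩ := eventually_distABW_conical hL hV hW
    have h1 : Tendsto (fun u : ℝ => ‖V - W‖ ^ 2 - u * (u * C)) (𝓝[>] 0) (𝓝 (‖V - W‖ ^ 2)) := by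
      have : Tendsto (fun u : ℝ => ‖V - W‖ ^ 2 - u * (u * C)) (𝓝 0)
          (𝓝 (‖V - W‖ ^ 2 - 0 * (0 * C))) :=
        (continuous_const.sub (continuous_id.mul (continuous_id.mul continuous_const))).tendsto 0
      rw [zero_mul, sub_zero] at this
      exact this.mono_left nhdsWithin_le_nhds
    refine tendsto_of_tendsto_of_tendsto_of_le_of_le' h1 tendsto_const_nhds ?_ ?_
    · filter_upwards [hC, self_mem_nhdsWithin] with u hu hu0
      have hu0 : 0 < u := hu0
      rw [le_div_iff₀ (by positivity)]
      nlinarith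
    · filter_upwards [self_mem_nhdsWithin] with u hu0
      have hu0 : 0 < u := hu0
      rw [div_le_iff₀ (by positivity), mul_comm, ← mul_pow]
      refine pow_le_pow_left₀ (by rw [distABW_cls]; exact Real.sqrt_nonneg _) ?_ 2
      refine (distABW_le_norm_sub _ _).trans_eq ?_
      rw [add_sub_add_left_eq_sub, ← smul_sub, norm_smul, Real.norm_eq_abs, abs_of_pos hu0]
  nonbranching V W hV hW hVW := by
    obtain ⟨O, hO⟩ := cls_eq_cls_iff.1 hVW
    have hn : ‖V‖ = ‖W‖ := by
      have h1 := distABW_half hV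
      rw [hVW, distABW_half hW] at h1
      linarith
    set N := L + (1 / 2 : ℝ) • V with hN
    set N' := L + (1 / 2 : ℝ) • W with hN'
    have hhalf : ∀ U : BlockLower T d, ‖(1 / 2 : ℝ) • U‖ = ‖U‖ / 2 := fun U => by
      rw [norm_smul]; norm_num; ring
    have d1 : ‖mulO L O - N‖ = ‖V‖ / 2 := by
      rw [hO, ← mulO_sub, norm_mulO, hN', sub_add_cancel_left, norm_neg, hhalf, hn]
    have d2 : ‖N - (L + V)‖ = ‖V‖ / 2 := by
      have : N - (L + V) = -((1 / 2 : ℝ) • V) := by rw [hN]; module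
      rw [this, norm_neg, hhalf]
    have d3 : ‖mulO L O - (L + V)‖ = ‖V‖ := by
      refine le_antisymm ?_ ?_
      · have := norm_sub_le_norm_sub_add_norm_sub (mulO L O) N (L + V)
        linarith
      · have := distABW_le_norm_sub (mulO L O) (L + V)
        rwa [show cls (mulO L O) = cls L from cls_eq_cls_iff.2 ⟨O, rfl⟩, hV] at this
    -- N is also the midpoint of L and L + V, so LO = L. Then O is trivial and the two lifted
    -- midpoints coincide.
    have hmid : N = midpoint ℝ (mulO L O) (L + V) := by
      refine eq_midpoint_of_dist_eq_half ?_ ?_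
      · rw [dist_eq_norm, dist_eq_norm, d1, d3]
      · rw [dist_eq_norm, dist_eq_norm, d2, d3]
    have hL' : mulO L O = L := by
      rw [midpoint_eq_smul_add, invOf_eq_inv] at hmid
      have : mulO L O = (2 : ℝ) • N - (L + V) := by rw [hmid]; module
      rw [this, hN]; module
    rw [mulO_eq_of_mulO_eq_self hL hL'] at hO
    have : (1 / 2 : ℝ) • V = (1 / 2 : ℝ) • W := add_left_cancel hO
    exact smul_right_injective _ (by norm_num : (1 / 2 : ℝ) ≠ 0) this

end Horizontal

/-! ### Uniqueness of geodesics from a regular point -/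

section Uniqueness

variable {T d : ℕ}

/-- The block column of `M` at time `t`. -/
def colBlock (M : BlockLower T d) (t : Fin T) : Matrix (Fin d × Fin T) (Fin d) ℝ :=
  (mat M).submatrix id fun i => (i, t)

theorem gramBlock_eq_colBlock (A B : BlockLower T d) (t : Fin T) :
    gramBlock A B t = (colBlock A t)ᵀ * colBlock B t := rfl

theorem mulO_eq_mulO_iff {M : BlockLower T d} {P Q : OGroup T d} :
    mulO M P = mulO M Q ↔ ∀ t, colBlock M t * (P t : Matrix (Fin d) (Fin d) ℝ) =
      colBlock M t * (Q t : Matrix (Fin d) (Fin d) ℝ) := by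
  have key : ∀ (R : OGroup T d) a j t, mat (mulO M R) a (j, t) =
      (colBlock M t * (R t : Matrix (Fin d) (Fin d) ℝ)) a j := by
    intro R a j t
    change (mat M * R.toMatrix) a (j, t) = _
    rw [Matrix.mul_apply, Fintype.sum_prod_type, Matrix.mul_apply]
    simp [OGroup.toMatrix, Matrix.blockDiagonal_apply, colBlock]
  constructor
  · intro h t
    ext a j
    rw [← key, ← key, h]
  · intro h
    refine Subtype.ext (Matrix.ext fun a b => ?_)
    change mat (mulO M P) a (b.1, b.2) = mat (mulO M Q) a (b.1, b.2)
    rw [key, key, h]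

/-- The rank condition says that all the optimal `P` give the same `M P`. -/
theorem forall_mulO_eq_iff_rank_eq (L M : BlockLower T d) :
    (∀ P ∈ optO L M, ∀ Q ∈ optO L M, mulO M P = mulO M Q) ↔
      ∀ t, (gramBlock M M t).rank = (gramBlock M L t).rank := by
  constructor
  · intro h t
    by_contra hr
    rw [gramBlock_eq_colBlock, gramBlock_eq_colBlock, rank_transpose_mul_eq_iff] at hr
    push Not at hr
    obtain ⟨x, hx, hx0⟩ := hr
    have hxne : x ≠ 0 := by
      rintro rfl
      exact hx0 (Matrix.mulVec_zero _)
    obtain ⟨P, hP⟩ := optO_nonempty L M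
    have hP' := mem_optO_iff.1 hP
    have hker : (gramBlock M L t)ᵀ *ᵥ x = 0 := by
      rw [gramBlock_transpose]
      exact hx
    -- Reflecting in x gives another optimal factor; if MP did not change, M_t x would equal -M_t x.
    have hR := (hP' t).householder_mul hxne hker
    let Q : OGroup T d := Function.update P t ⟨_, hR.1⟩
    have hQt : (Q t : Matrix (Fin d) (Fin d) ℝ) =
        householder x * (P t : Matrix (Fin d) (Fin d) ℝ) := by simp [Q]
    have hQ : Q ∈ optO L M := mem_optO_iff.2 fun s => by
      by_cases hs : s = t
      · subst hs
        rw [hQt]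
        exact hR
      · rw [show Q s = P s from Function.update_of_ne hs _ _]
        exact hP' s
    have h1 := mulO_eq_mulO_iff.1 (h P hP Q hQ) t
    rw [hQt] at h1
    have h2 : colBlock M t = colBlock M t * householder x := by
      have := congrArg (· * (P t : Matrix (Fin d) (Fin d) ℝ)ᵀ) h1
      simpa only [Matrix.mul_assoc, (hP' t).mul_transpose_self, Matrix.mul_one] using this
    have h3 : householder x *ᵥ x = -x := by
      rw [householder, Matrix.sub_mulVec, Matrix.one_mulVec, Matrix.smul_mulVec,
        Matrix.vecMulVec_mulVec, op_smul_eq_smul, smul_smul,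
        div_mul_cancel₀ _ (dotProduct_self_pos hxne).ne', two_smul]
      abel
    have h4 : colBlock M t *ᵥ x = -(colBlock M t *ᵥ x) := by
      conv_lhs => rw [h2]
      rw [← Matrix.mulVec_mulVec, h3, Matrix.mulVec_neg]
    exact hx0 (self_eq_neg.1 h4)
  · intro h P hP Q hQ
    refine mulO_eq_mulO_iff.2 fun t => ?_
    -- Equal positive parts put the columns of P_t - Q_t in the kernel of (LᵀM)_{t,t}, which the
    -- rank condition sends into the kernel of M_t.
    have h1 := (mem_optO_iff.1 hP t).transpose_mul_eq (mem_optO_iff.1 hQ t)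
    have h2 : (gramBlock M L t)ᵀ * ((P t : Matrix (Fin d) (Fin d) ℝ) - Q t) = 0 := by
      have := congrArg Matrix.transpose h1
      rw [Matrix.transpose_mul, Matrix.transpose_mul, Matrix.transpose_transpose,
        Matrix.transpose_transpose] at this
      rw [mul_sub, this, sub_self]
    have h3 := h t
    rw [gramBlock_eq_colBlock, gramBlock_eq_colBlock, rank_transpose_mul_eq_iff] at h3
    rw [gramBlock_transpose, gramBlock_eq_colBlock] at h2
    rw [← sub_eq_zero, ← Matrix.mul_sub]
    ext a j
    have h4 := h3 (((P t : Matrix (Fin d) (Fin d) ℝ) - Q t).col j) (by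
      funext i
      exact congrFun (congrFun h2 i) j)
    exact congrFun h4 a

theorem isGeodesic_cls_iff {L : BlockLower T d} (hL : IsRegularBW L) {M : BlockLower T d}
    {γ : I → ABWSpace T d} :
    IsGeodesic distABW (cls L) (cls M) γ ↔
      ∃ P ∈ optO L M, γ = displacement L (mulO M P - L) := by
  rw [(isTangentModel hL).isGeodesic_iff]
  constructor
  · rintro ⟨V, h1, h2, rfl⟩
    obtain ⟨P, hP⟩ := cls_eq_cls_iff.1 h1
    have hV : V = mulO M P - L := by rw [← hP, add_sub_cancel_left]
    refine ⟨P, mem_optO_of_distABW_eq ?_, by rw [hV]; rfl⟩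
    rw [← h2, hV, norm_sub_rev]
  · rintro ⟨P, hP, rfl⟩
    refine ⟨mulO M P - L, ?_, ?_, rfl⟩
    · rw [add_sub_cancel]
      exact cls_eq_cls_iff.2 ⟨P, rfl⟩
    · rw [distABW_eq_norm hP, norm_sub_rev]

theorem displacement_eq_iff {L : BlockLower T d} (hL : IsRegularBW L) {M : BlockLower T d}
    {P Q : OGroup T d} (hP : P ∈ optO L M) (hQ : Q ∈ optO L M) :
    displacement L (mulO M P - L) = displacement L (mulO M Q - L) ↔ mulO M P = mulO M Q := by
  refine ⟨fun h => ?_, fun h => by rw [h]⟩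
  exact sub_left_injective ((isTangentModel hL).eq_of_segment_eq
    (mulO_sub_mem_tangentSpace hP) (mulO_sub_mem_tangentSpace hQ) h)

theorem existsUnique_isGeodesic_iff {L : BlockLower T d} (hL : IsRegularBW L)
    (M : BlockLower T d) :
    (∃! γ : I → ABWSpace T d, IsGeodesic distABW (cls L) (cls M) γ) ↔
      ∀ t, (gramBlock M M t).rank = (gramBlock M L t).rank := by
  rw [← forall_mulO_eq_iff_rank_eq]
  constructor
  · intro h P hP Q hQ
    exact (displacement_eq_iff hL hP hQ).1 (h.unique ((isGeodesic_cls_iff hL).2 ⟨P, hP, rfl⟩)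
      ((isGeodesic_cls_iff hL).2 ⟨Q, hQ, rfl⟩))
  · intro h
    obtain ⟨P, hP⟩ := optO_nonempty L M
    refine ⟨_, (isGeodesic_cls_iff hL).2 ⟨P, hP, rfl⟩, fun γ hγ => ?_⟩
    obtain ⟨Q, hQ, rfl⟩ := (isGeodesic_cls_iff hL).1 hγ
    rw [h P hP Q hQ]

/-- The isometry between the tangent cone at `[L]` and the horizontal space at `L`. -/
def tangentEquiv {L : BlockLower T d} (hL : IsRegularBW L) :
    TangentCone distABW (cls L) ≃ tangentSpace L :=
  (Equiv.ofBijective _ (isTangentModel hL).coneVec_bijective).trans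
    (Equiv.subtypeEquivRight fun _ => Iff.rfl)

theorem isTangentIsometry_tangentEquiv {L : BlockLower T d} (hL : IsRegularBW L) :
    IsTangentIsometry L (tangentEquiv hL) where
  isometry x y := by
    rw [← norm_eq_frobNorm]
    exact (isTangentModel hL).norm_coneVec_sub x y
  velocity V h := (isTangentModel hL).coneVec_velocity ⟨V.1, V.2⟩ h

/-- The endpoint is kept as a variable because the velocity depends on it through the geodesic
proof; it can then be [M] instead of [L + (MP - L)]. -/
theorem IsTangentIsometry.symm_apply_eq_velocity {L : BlockLower T d}
    {ι : TangentCone distABW (cls L) ≃ tangentSpace L} (hι : IsTangentIsometry L ι)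
    (V : tangentSpace L) {q : ABWSpace T d} (hq : q = cls (L + V.1))
    (h : IsGeodesic distABW (cls L) q (displacement L V.1)) :
    ι.symm V = AdaptedBW.velocity _ h := by
  subst hq
  rw [Equiv.symm_apply_eq, hι.velocity]

end Uniqueness

end AdaptedBW

end

theorem theorem1p5 {T d : ℕ} (L : BlockLower T d) (hL : IsRegularBW L) :
    ∃ ι : TangentCone distABW (cls L) ≃ tangentSpace L, IsTangentIsometry L ι ∧
      ∀ M : BlockLower T d,
        ((∃! γ : unitInterval → ABWSpace T d, IsGeodesic distABW (cls L) (cls M) γ) ↔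
          ∀ t : Fin T, (gramBlock M M t).rank = (gramBlock M L t).rank) ∧
        ((∀ t : Fin T, (gramBlock M M t).rank = (gramBlock M L t).rank) →
          (optO L M).Nonempty ∧
          ∀ P ∈ optO L M,
            (∃ hV : mulO M P - L ∈ tangentSpace L,
              HasLog (cls L) (cls M) (ι.symm ⟨mulO M P - L, hV⟩)) ∧
            ∀ γ : unitInterval → ABWSpace T d, IsGeodesic distABW (cls L) (cls M) γ ↔
              γ = fun u : unitInterval => cls (L + (u : ℝ) • (mulO M P - L))) := by
  have hι := isTangentIsometry_tangentEquiv hL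
  refine ⟨tangentEquiv hL, hι, fun M => ⟨existsUnique_isGeodesic_iff hL M,
    fun hr => ⟨optO_nonempty L M, fun P hP => ?_⟩⟩⟩
  have hγ : IsGeodesic distABW (cls L) (cls M) (displacement L (mulO M P - L)) :=
    (isGeodesic_cls_iff hL).2 ⟨P, hP, rfl⟩
  have huniq : ∀ η, IsGeodesic distABW (cls L) (cls M) η → η = displacement L (mulO M P - L) :=
    fun η hη => ((existsUnique_isGeodesic_iff hL M).2 hr).unique hη hγ
  refine ⟨⟨mulO_sub_mem_tangentSpace hP, _, hγ, huniq, ?_⟩, fun γ => ⟨huniq γ, ?_⟩⟩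
  · refine hι.symm_apply_eq_velocity ⟨_, mulO_sub_mem_tangentSpace hP⟩ ?_ hγ
    rw [add_sub_cancel]
    exact cls_eq_cls_iff.2 ⟨P⁻¹, by rw [mulO_mulO, mul_inv_cancel, mulO_one]⟩
  · rintro rfl
    exact hγ
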